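/- **Setting.** Let $m\in\mathbb Z_{\ge 0}$, $a,b,c,d,\hbar\in\mathbb C$ and $J\in\{\mathrm{II,III,IV,V,VI}\}$. Put $p=\hbar\,\partial/\partial x$ and define the Hamiltonians $$\begin{aligned} t(t-1)\widehat H_{\mathrm{VI}}&=x(x-1)(x-t)p^2-\bigl((a+b)(x-1)(x-t)+cx(x-t)+dx(x-1)\bigr)p+(b+c+d+\hbar)a(x-t),\\ t\widehat H_{\mathrm V}&=x(x-1)p^2+\bigl(tx^2-(b+c+t)x+b\bigr)p+a(b+c-a+\hbar+t-tx),\\ \widehat H_{\mathrm{IV}}&=-xp^2-(x^2-tx-b)p+a(x-t),\\ t\widehat H_{\mathrm{III}}&=x^2p^2-(x^2+bx+t)p+ax,\\ \widehat H_{\mathrm{II}}&=\tfrac12p^2-\bigl(x^2+\tfrac t2\bigr)p+ax, \end{aligned}$$ and the master functions $$\rho_{\mathrm{VI}}=u^{-a-b-1}(1-u)^{-c-1}(t-u)^{-d},\quad \rho_{\mathrm V}=u^{-b-1}(1-u)^{-c-1}e^{ut},\quad \rho_{\mathrm{IV}}=u^{-b-1}e^{-ut+u^2/2},$$ $$\rho_{\mathrm{III}}=u^{-b-1}e^{t/u-u},\quad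 \rho_{\mathrm{II}}=e^{-(ut+\frac23u^3)} .$$ Consider the many-valued integrand $\prod_{i<j}(u_i-u_j)^{2\hbar}\prod_i\rho_J(u_i)$ on $\mathbb C^m$. Its singular locus at time $t$ is the union of the hyperplanes $u_i=u_j$, $u_i=0$, $u_i=1$, $u_i=t$ for which the corresponding linear factor occurs with an exponent not in $\mathbb Z_{\ge 0}$, and, for $J=\mathrm{III}$, always also of the hyperplanes $u_i=0$. Let $T\subset\mathbb C$ be open, with $0\notin T$ if $J=\mathrm{III},\mathrm V$, and $0,1\notin T$ if $J=\mathrm{VI}$. Let $\Gamma$ be an $m$-cycle of the (rapid decay) twisted homology determined by the integrand, over $T$: a locally finite, possibly infinite, chain of smooth singular $m$-cubes which avoid the singular locus for every $t\in T$, do not depend on $t$, and carry coefficients in the rank one local system generated by the branches of the integrand (without its polynomial factors), continued in $t\in T$; its boundary is zero modulo degenerate cubes; and along it these coefficients decay faster than any power of the distance to the singular locus and to infinity. Precisely, for every compact $K\subset T$ and every $N$, the suprema over $t\in K$ and over the cube of $|w_s|\,g^N(1+\|D\sigma_s\|)^m$ are bounded by the terms of a convergent series in $s$, where $\sigma_s$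 are the cubes, $w_s$ their coefficients, and $g$ is $1+|u|$ plus the sum of the inverse absolute values of the factors vanishing on the singular locus. (Local finiteness and decay are automatic for a finite chain.) **Theorem.** Suppose that $a=m\hbar$, or, in the case $J=\mathrm{VI}$ alternatively, that $b+c+d=(m-1)\hbar$. Then the integral $$\Phi^J_m(x,t)=\int_\Gamma\prod_{1\le i<j\le m}(u_i-u_j)^{2\hbar}\prod_{i=1}^m\rho_J(u_i)(x-u_i)\,du_i\qquad(x\in\mathbb C,\ t\in T)$$ converges absolutely, it is a polynomial in $x$ of degree at most $m$ whose coefficients are holomorphic functions of $t\in T$, and it is a solution of the Schrödinger equation $$\hbar\,\frac{\partial}{\partial t}\Phi^J_m(x,t)=\widehat H_J\,\Phi^J_m(x,t).$$ -/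

import Mathlib

open Set MeasureTheory
open scoped ContDiff

noncomputable section

namespace QuantumPainleve

/-- The types of the quantum Painlevé equations. -/
inductive PType
  | II | III | IV | V | VI

/-- The complex parameters `a, b, c, d` and `ħ` (a type that does not involve one of them
ignores it). -/
structure Params where
  a : ℂ
  b : ℂ
  c : ℂ
  d : ℂ
  hbar : ℂ

/-! ### The Schrödinger operators -/

/-- The quantized momentum `ħ ∂/∂x`. -/
def momentum (hbar : ℂ) (f : ℂ → ℂ) : ℂ → ℂ := fun x => hbar * deriv f x

/-- The quantized Hamiltonian of type `J` at time `t`, as a differential operator in `x`. -/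
def hamiltonian (J : PType) (P : Params) (t : ℂ) (f : ℂ → ℂ) (x : ℂ) : ℂ :=
  let p := momentum P.hbar
  match J with
  | .VI =>
      (x * (x - 1) * (x - t) * p (p f) x
        - ((P.a + P.b) * (x - 1) * (x - t) + P.c * x * (x - t) + P.d * x * (x - 1)) * p f x
        + (P.b + P.c + P.d + P.hbar) * P.a * (x - t) * f x) / (t * (t - 1))
  | .V =>
      (x * (x - 1) * p (p f) x
        + (t * x ^ 2 - (P.b + P.c + t) * x + P.b) * p f x
        + P.a * (P.b + P.c - P.a + P.hbar + t - t * x) * f x) / t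
  | .IV =>
      -(x * p (p f) x) - (x ^ 2 - t * x - P.b) * p f x + P.a * (x - t) * f x
  | .III =>
      (x ^ 2 * p (p f) x - (x ^ 2 + P.b * x + t) * p f x + P.a * x * f x) / t
  | .II =>
      1 / 2 * p (p f) x - (x ^ 2 + t / 2) * p f x + P.a * x * f x

/-- The times at which the equation of type `J` is not singular. -/
def timeDomain : PType → Set ℂ
  | .II => univ
  | .III => {0}ᶜ
  | .IV => univ
  | .V => {0}ᶜ
  | .VI => {0, 1}ᶜ

/-- The condition on the parameters: `a = mħ`, or, for type VI alternatively,
`b + c + d = (m - 1)ħ`. -/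
def ParamCondition (J : PType) (P : Params) (m : ℕ) : Prop :=
  match J with
  | .VI => P.a = m * P.hbar ∨ P.b + P.c + P.d = ((m : ℂ) - 1) * P.hbar
  | _ => P.a = m * P.hbar

/-! ### The integrand

The integrand is `∏_{i<j} (u_i - u_j)^{2ħ} ∏_i ρ_J(u_i) (x - u_i)`, and each master function is
`ρ_J(u) = u^{e₀} (1 - u)^{e₁} (t - u)^{e₂} exp (h_J(t, u))`, where an absent factor has
exponent `0`. -/

/-- The exponents `(e₀, e₁, e₂)` of `u`, `1 - u` and `t - u` in the master function. -/
def masterExponents (J : PType) (P : Params) : Fin 3 → ℂ :=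
  match J with
  | .VI => ![-P.a - P.b - 1, -P.c - 1, -P.d]
  | .V => ![-P.b - 1, -P.c - 1, 0]
  | .IV => ![-P.b - 1, 0, 0]
  | .III => ![-P.b - 1, 0, 0]
  | .II => ![0, 0, 0]

/-- The function `h_J(t, u)` in the exponential factor of the master function. -/
def masterExp (J : PType) (t u : ℂ) : ℂ :=
  match J with
  | .VI => 0
  | .V => u * t
  | .IV => -u * t + u ^ 2 / 2
  | .III => t / u - u
  | .II => -(u * t + 2 / 3 * u ^ 3)

/-- Index set of the factors `u_i - u_j` (`i < j`), and `u_i`, `1 - u_i`, `t - u_i`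
(numbered `0, 1, 2`). -/
abbrev Factor (m : ℕ) : Type := {q : Fin m × Fin m // q.1 < q.2} ⊕ (Fin m × Fin 3)

/-- The value of a factor at the point `u` and time `t`. -/
def factorValue {m : ℕ} (t : ℂ) (u : Fin m → ℂ) : Factor m → ℂ
  | .inl q => u q.1.1 - u q.1.2
  | .inr (i, k) => ![u i, 1 - u i, t - u i] k

/-- The exponent with which a factor occurs in the integrand. -/
def factorExponent (J : PType) (P : Params) {m : ℕ} : Factor m → ℂ
  | .inl _ => 2 * P.hbar
  | .inr (_, k) => masterExponents J P k

/-- A factor belongs to the singular locus of the integrand unless its exponent is a natural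
number (so that its power is a polynomial); the essential singularity `u_i = 0` of type III
always belongs to it. -/
def IsSingular (J : PType) (P : Params) {m : ℕ} (f : Factor m) : Prop :=
  (∀ n : ℕ, factorExponent J P f ≠ n) ∨ (J = .III ∧ ∃ i : Fin m, f = .inr (i, 0))

/-- The complement in `ℂ^m` of the singular locus of the integrand at time `t`. -/
def configSpace (J : PType) (P : Params) (m : ℕ) (t : ℂ) : Set (Fin m → ℂ) :=
  {u | ∀ f : Factor m, IsSingular J P f → factorValue t u f ≠ 0}

open Classical in
/-- The polynomial part of the integrand: the product of the powers of the nonsingular factors,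
all of which have exponents in `ℕ`. -/
def polyPart (J : PType) (P : Params) {m : ℕ} (t : ℂ) (u : Fin m → ℂ) : ℂ :=
  ∏ f : Factor m, if IsSingular J P f then 1 else factorValue t u f ^ factorExponent J P f

open Classical in
/-- `1 + |u| + ∑ 1/|g(u)|` over the singular factors `g`: it is large near infinity and near the
singular locus, and only there. -/
def growth (J : PType) (P : Params) {m : ℕ} (t : ℂ) (u : Fin m → ℂ) : ℝ :=
  1 + ‖u‖ + ∑ f : Factor m, if IsSingular J P f then ‖factorValue t u f‖⁻¹ else 0

/-! ### Twisted cycles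

Smooth singular cubical chains with coefficients in the rank one local system that is generated by
the branches of `∏ g^{λ_g} exp (∑ h_J(t, u_i))`, the product being over the singular factors. They
may be infinite; the integrand has to decay rapidly along them. -/

/-- The standard cube `[0,1]^k`. -/
def stdCube (k : ℕ) : Set (Fin k → ℝ) := Icc 0 1

open Classical in
/-- `w` is a section along `σ`, for times in `T`, of the local system: a constant multiple of a
branch of the many-valued part of the integrand, continued along `[0,1]^k × T`. -/
def IsSection (J : PType) (P : Params) {m k : ℕ} (T : Set ℂ)
    (σ : (Fin k → ℝ) → (Fin m → ℂ)) (w : (Fin k → ℝ) → ℂ → ℂ) : Prop :=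
  ∃ (C : ℂ) (l : Factor m → (Fin k → ℝ) × ℂ → ℂ),
    (∀ f, IsSingular J P f → ContinuousOn (l f) (stdCube k ×ˢ T) ∧
      ∀ p ∈ stdCube k, ∀ t ∈ T, Complex.exp (l f (p, t)) = factorValue t (σ p) f) ∧
    ∀ p ∈ stdCube k, ∀ t ∈ T,
      w p t = C * Complex.exp
        ((∑ f : Factor m, if IsSingular J P f then factorExponent J P f * l f (p, t) else 0)
          + ∑ i, masterExp J t (σ p i))

/-- A smooth singular `k`-cube in the complement of the singular locus, the same for all times
`t ∈ T`, with a coefficient in the local system. -/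
structure TwistedCube (J : PType) (P : Params) (m : ℕ) (T : Set ℂ) (k : ℕ) where
  map : (Fin k → ℝ) → (Fin m → ℂ)
  smooth : ContDiffOn ℝ ∞ map (stdCube k)
  mem : ∀ t ∈ T, ∀ p ∈ stdCube k, map p ∈ configSpace J P m t
  coeff : (Fin k → ℝ) → ℂ → ℂ
  isSection : IsSection J P T map coeff

/-- The inclusion of `[0,1]^n` as the face `p_i = 0` (`ε = false`) or `p_i = 1` (`ε = true`) of
`[0,1]^{n+1}`. -/
def facePoint {n : ℕ} (i : Fin (n + 1)) (ε : Bool) (p : Fin n → ℝ) : Fin (n + 1) → ℝ :=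
  Fin.insertNth (α := fun _ => ℝ) i (if ε then 1 else 0) p

/-- The sign of a face in the cubical boundary operator. -/
def faceSign {n : ℕ} (i : Fin (n + 1)) (ε : Bool) : ℂ :=
  (-1) ^ ((i : ℕ) + if ε then 0 else 1)

/-- A cube is degenerate if it does not depend on one of its coordinates. -/
def IsDegenerate {m n : ℕ} (τ : (Fin n → ℝ) → (Fin m → ℂ)) : Prop :=
  ∃ i : Fin n, ∀ p ∈ stdCube n, ∀ q ∈ stdCube n, (∀ j, j ≠ i → p j = q j) → τ p = τ q

/-- The boundary of the chain of `m`-cubes vanishes modulo degenerate cubes: for every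
nondegenerate `(m-1)`-cube `τ`, the sum of the coefficients, with signs, of all faces that
coincide with `τ` is zero. Every `0`-chain is closed. -/
def IsClosedChain (J : PType) (P : Params) (T : Set ℂ) {ι : Type*} :
    (m : ℕ) → (ι → TwistedCube J P m T m) → Prop
  | 0, _ => True
  | n + 1, c => ∀ τ : (Fin n → ℝ) → (Fin (n + 1) → ℂ), ¬ IsDegenerate τ →
      ∀ t ∈ T, ∀ p ∈ stdCube n,
        ∑ᶠ (q : ι × Fin (n + 1) × Bool)
          (_ : EqOn (fun r => (c q.1).map (facePoint q.2.1 q.2.2 r)) τ (stdCube n)),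
          faceSign q.2.1 q.2.2 * (c q.1).coeff (facePoint q.2.1 q.2.2 p) t = 0

/-- An `m`-cycle of the twisted homology determined by the integrand, over the set `T` of times:
a locally finite chain of twisted `m`-cubes with zero boundary along which the integrand decays
faster than any power of the distance to the singular locus and to infinity (uniformly for `t` in
compact subsets of `T`). For a finite chain the conditions of local finiteness and of decay hold
automatically. -/
structure TwistedCycle (J : PType) (P : Params) (m : ℕ) (T : Set ℂ) (ι : Type*) where
  cube : ι → TwistedCube J P m T m
  locallyFinite : ∀ t ∈ T, ∀ K ⊆ configSpace J P m t, IsCompact K →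
    {s | ∃ p ∈ stdCube m, (cube s).map p ∈ K}.Finite
  rapidDecay : ∀ K ⊆ T, IsCompact K → ∀ N : ℕ, ∃ B : ι → ℝ, Summable B ∧
    ∀ s, ∀ t ∈ K, ∀ p ∈ stdCube m,
      ‖(cube s).coeff p t‖ * growth J P t ((cube s).map p) ^ N
        * (1 + ‖fderivWithin ℝ (cube s).map (stdCube m) p‖) ^ m ≤ B s
  closed : IsClosedChain J P T m cube

/-! ### The integral -/

/-- The determinant by which `du_1 ∧ ⋯ ∧ du_m` pulls back to the cube. -/
def jacobian {m : ℕ} (σ : (Fin m → ℝ) → (Fin m → ℂ)) (p : Fin m → ℝ) : ℂ :=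
  (Matrix.of fun i j : Fin m => fderivWithin ℝ σ (stdCube m) p (Pi.single j 1) i).det

variable {J : PType} {P : Params} {m : ℕ} {T : Set ℂ} {ι : Type*}

/-- The integrand `∏_{i<j} (u_i - u_j)^{2ħ} ∏_i ρ_J(u_i) (x - u_i) du_i` pulled back to a cube. -/
def pullbackIntegrand (σ : TwistedCube J P m T m) (x t : ℂ) (p : Fin m → ℝ) : ℂ :=
  σ.coeff p t * polyPart J P t (σ.map p) * (∏ i, (x - σ.map p i)) * jacobian σ.map p

/-- The integral `Φ_m^J(x, t)` over the twisted cycle `Γ`. -/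
def hypergeometricIntegral (Γ : TwistedCycle J P m T ι) (x t : ℂ) : ℂ :=
  ∑' s, ∫ p in stdCube m, pullbackIntegrand (Γ.cube s) x t p

end QuantumPainleve

end

noncomputable section

namespace QuantumPainleve

open Filter Topology

variable {J : PType} {P : Params} {m : ℕ} {T : Set ℂ} {ι : Type*}

/-! Write the integrand as `Ψ ∏ (x - u_i)`. For each fixed `x` and `t`, applying the Hamiltonian
minus `ħ ∂/∂t` to it gives `ħ ∑_k ∂/∂u_k (Ψ α(u_k) ∏_{j ≠ k} (x - u_j))`, where `α = formCoeff J t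
x` is a polynomial of degree at most two in `u`. A cycle without boundary, along which the integrand
decays rapidly, does not see total derivatives, so the equation follows by integration.

After division by the integrand, the algebraic identity splits into two identities in few variables.
The value of `α` at `u = x` is the coefficient of `p²`. Hence the interaction `(u_i - u_j)^{2ħ}`
produces the second order term plus a constant for each pair (`formCoeff_pair_identity`). The
logarithmic derivative of the master function produces the first order term, the time derivative and
a constant for each variable (`formCoeff_identity`). These constants add up to the term of order
zero exactly by the condition on the parameters (`hamCoeffZero_eq`). The division is legitimate only
at generic points; continuity extends the identity to the whole configuration space
(`eq_zero_of_generic`, `schrodinger_identity`).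

The analysis rests on the class `ModerateOn` of functions bounded by powers of `growth`: rapid decay
makes their integrals converge, uniformly for times in compact sets, and permits differentiation in
`t` (`hasDerivAt_cycleIntegral`). The theorem of Stokes (`cycleIntegral_total_derivative`) comes
from the divergence theorem on each cube, combined with the Piola identity for cofactors.
Nondegenerate faces then cancel by closedness, and degenerate faces have vanishing Jacobian minors.
No differentiation under the integral in `x` is needed, since the integral is a polynomial in `x`
with integrals as coefficients. -/

/-! ### The factors of the integrand -/

/-- The derivative of a factor in the direction `(τ, v)` of the `(t, u)`-space. -/
def factorSlope {m : ℕ} (τ : ℂ) (v : Fin m → ℂ) : Factor m → ℂ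
  | .inl q => v q.1.1 - v q.1.2
  | .inr (i, k) => ![v i, -v i, τ - v i] k

/-- All factors are affine in `(t, u)`. Their derivatives, and their behaviour on the lines used to
reach generic points, both come from this. -/
lemma factorValue_add (t τ : ℂ) (u v : Fin m → ℂ) (f : Factor m) :
    factorValue (t + τ) (u + v) f = factorValue t u f + factorSlope τ v f := by
  rcases f with q | ⟨i, k⟩
  · simp [factorValue, factorSlope]; ring
  · fin_cases k <;> (simp [factorValue, factorSlope]; try ring)

lemma factorSlope_add (τ τ' : ℂ) (v v' : Fin m → ℂ) (f : Factor m) :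
    factorSlope (τ + τ') (v + v') f = factorSlope τ v f + factorSlope τ' v' f := by
  rcases f with q | ⟨i, k⟩
  · simp [factorSlope]; ring
  · fin_cases k <;> simp [factorSlope] <;> ring

lemma factorSlope_smul (c τ : ℂ) (v : Fin m → ℂ) (f : Factor m) :
    factorSlope (c * τ) (c • v) f = c * factorSlope τ v f := by
  rcases f with q | ⟨i, k⟩
  · simp [factorSlope]; ring
  · fin_cases k <;> (simp [factorSlope]; try ring)

/-- `factorSlope 0 · f` as a continuous linear map. -/
def factorSlopeCLM (f : Factor m) : (Fin m → ℂ) →L[ℂ] ℂ :=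
  LinearMap.toContinuousLinearMap
    { toFun := fun v => factorSlope 0 v f
      map_add' := fun v v' => by simpa using factorSlope_add 0 0 v v' f
      map_smul' := fun c v => by simpa using factorSlope_smul c 0 v f }

@[simp] lemma factorSlopeCLM_apply (f : Factor m) (v : Fin m → ℂ) :
    factorSlopeCLM f v = factorSlope 0 v f := rfl

lemma continuous_factorValue (f : Factor m) :
    Continuous fun q : ℂ × (Fin m → ℂ) => factorValue q.1 q.2 f := by
  rcases f with q | ⟨i, k⟩
  · simp only [factorValue]; fun_prop
  · fin_cases k <;> (simp [factorValue]; fun_prop)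

lemma hasFDerivAt_factorValue (f : Factor m) (t : ℂ) (u : Fin m → ℂ) :
    HasFDerivAt (fun u => factorValue t u f) (factorSlopeCLM f) u := by
  have h : (fun u => factorValue t u f) = fun v : Fin m → ℂ =>
      factorSlopeCLM f v + factorValue t 0 f := by
    funext v
    simpa [add_comm] using factorValue_add t 0 0 v f
  rw [h]
  exact (factorSlopeCLM f).hasFDerivAt.add_const _

lemma hasDerivAt_factorValue (f : Factor m) (t : ℂ) (u : Fin m → ℂ) :
    HasDerivAt (fun t => factorValue t u f) (factorSlope 1 0 f) t := by
  have h : (fun t => factorValue t u f) = fun t : ℂ =>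
      t * factorSlope 1 0 f + factorValue 0 u f := by
    funext s
    have h1 := factorValue_add 0 s u 0 f
    have h2 := factorSlope_smul s 1 (0 : Fin m → ℂ) f
    simp only [zero_add, add_zero, mul_one, smul_zero] at h1 h2
    rw [h1, h2, add_comm]
  rw [h]
  simpa using ((hasDerivAt_id t).mul_const (factorSlope 1 0 f)).add_const (factorValue 0 u f)

lemma isOpen_configSpace (t : ℂ) : IsOpen (configSpace J P m t) := by
  have : configSpace J P m t =
      ⋂ f : Factor m, ⋂ _ : IsSingular J P f, {u | factorValue t u f ≠ 0} := by
    ext u; simp [configSpace]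
  rw [this]
  refine isOpen_iInter_of_finite fun f => isOpen_iInter_of_finite fun _ => ?_
  exact isOpen_ne_fun ((continuous_factorValue f).comp (by fun_prop : Continuous fun u => (t, u)))
    continuous_const

/-! ### Splitting the integrand into a many-valued and a polynomial part, and logarithmic
derivatives -/

open Classical in
/-- The exponent of a nonsingular factor, as a natural number; `0` for a singular factor. -/
def natExp (J : PType) (P : Params) (f : Factor m) : ℕ :=
  if h : ¬ IsSingular J P f ∧ ∃ n : ℕ, factorExponent J P f = n then h.2.choose else 0

open Classical in
/-- The exponent of a singular factor; `0` for a nonsingular factor. -/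
def singExp (J : PType) (P : Params) (f : Factor m) : ℂ :=
  if IsSingular J P f then factorExponent J P f else 0

lemma natExp_of_isSingular {f : Factor m} (hf : IsSingular J P f) : natExp J P f = 0 :=
  dif_neg fun h => h.1 hf

lemma natExp_of_not_isSingular {f : Factor m} (hf : ¬ IsSingular J P f) :
    factorExponent J P f = natExp J P f := by
  have h : ∃ n : ℕ, factorExponent J P f = n := by
    by_contra h
    exact hf (Or.inl fun n hn => h ⟨n, hn⟩)
  rw [natExp, dif_pos ⟨hf, h⟩]
  exact h.choose_spec

/-- Each factor belongs wholly to one of the two parts. In type III a natural exponent of `u_i`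
still counts as singular, and `natExp` is `0` there, so nothing is counted twice. -/
lemma singExp_add_natExp (f : Factor m) :
    singExp J P f + natExp J P f = factorExponent J P f := by
  by_cases hf : IsSingular J P f
  · simp [singExp, hf, natExp_of_isSingular hf]
  · simp [singExp, hf, natExp_of_not_isSingular hf]

lemma polyPart_eq_prod (t : ℂ) (u : Fin m → ℂ) :
    polyPart J P t u = ∏ f, factorValue t u f ^ natExp J P f := by
  refine Finset.prod_congr rfl fun f _ => ?_
  by_cases hf : IsSingular J P f
  · simp [hf, natExp_of_isSingular hf]
  · rw [if_neg hf, natExp_of_not_isSingular hf, Complex.cpow_natCast]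

open Classical in
/-- The derivative of the polynomial part of the integrand in the direction `(τ, v)`. -/
def polyDeriv (J : PType) (P : Params) (t : ℂ) (u : Fin m → ℂ) (τ : ℂ) (v : Fin m → ℂ) : ℂ :=
  ∑ f, (∏ g ∈ Finset.univ.erase f, factorValue t u g ^ natExp J P g) *
    (natExp J P f * factorValue t u f ^ (natExp J P f - 1) * factorSlope τ v f)

lemma hasFDerivAt_polyPart (t : ℂ) (u : Fin m → ℂ) :
    ∃ L : (Fin m → ℂ) →L[ℂ] ℂ, HasFDerivAt (polyPart J P t) L u ∧
      ∀ v, L v = polyDeriv J P t u 0 v := by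
  classical
  have h := HasFDerivAt.finsetProd (u := Finset.univ) (x := u)
    (g := fun (f : Factor m) u => factorValue t u f ^ natExp J P f)
    fun f _ => (hasFDerivAt_factorValue f t u).pow (natExp J P f)
  refine ⟨_, h.congr_of_eventuallyEq (.of_forall fun v => ?_), fun v => ?_⟩
  · rw [polyPart_eq_prod]
  · simp [polyDeriv]

lemma hasDerivAt_polyPart (t : ℂ) (u : Fin m → ℂ) :
    HasDerivAt (fun t => polyPart J P t u) (polyDeriv J P t u 1 0) t := by
  classical
  have h := HasDerivAt.finsetProd (u := Finset.univ) (x := t)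
    (f := fun (f : Factor m) t => factorValue t u f ^ natExp J P f)
    fun f _ => (hasDerivAt_factorValue f t u).pow (natExp J P f)
  have h' : (fun t => polyPart J P t u) =
      ∏ f : Factor m, fun t => factorValue t u f ^ natExp J P f := by
    funext t; rw [polyPart_eq_prod]; simp
  rw [h']
  exact h.congr_deriv (by simp [polyDeriv])

/-- `∂h_J/∂t`. -/
def masterExpT (J : PType) (u : ℂ) : ℂ :=
  match J with
  | .VI => 0
  | .V => u
  | .IV => -u
  | .III => u⁻¹
  | .II => -u

/-- `∂h_J/∂u`. -/
def masterExpU (J : PType) (t u : ℂ) : ℂ :=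
  match J with
  | .VI => 0
  | .V => t
  | .IV => -t + u
  | .III => -t * (u⁻¹) ^ 2 - 1
  | .II => -(t + 2 * u ^ 2)

lemma hasDerivAt_masterExp_time (t u : ℂ) :
    HasDerivAt (fun t => masterExp J t u) (masterExpT J u) t := by
  cases J <;> simp only [masterExp, masterExpT]
  · simpa using (((hasDerivAt_id t).const_mul u).add_const (2 / 3 * u ^ 3)).fun_neg
  · simpa [div_eq_mul_inv] using ((hasDerivAt_id t).mul_const u⁻¹).sub_const u
  · simpa using ((hasDerivAt_id t).const_mul (-u)).add_const (u ^ 2 / 2)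
  · simpa using (hasDerivAt_id t).const_mul u
  · exact hasDerivAt_const _ _

lemma hasDerivAt_masterExp (t u : ℂ) (hu : J = .III → u ≠ 0) :
    HasDerivAt (masterExp J t) (masterExpU J t u) u := by
  cases J <;> unfold masterExp <;> simp only [masterExpU]
  · have h := (((hasDerivAt_id u).mul_const t).add
      (((hasDerivAt_id u).pow 3).const_mul (2 / 3))).neg
    refine h.congr_deriv ?_
    simp; ring
  · have h := ((hasDerivAt_inv (hu rfl)).const_mul t).sub (hasDerivAt_id u)
    refine h.congr_deriv ?_
    simp
  · have h := (((hasDerivAt_id u).neg).mul_const t).add (((hasDerivAt_id u).pow 2).div_const 2)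
    refine h.congr_deriv ?_
    simp
  · simpa using (hasDerivAt_id u).mul_const t
  · exact hasDerivAt_const _ _

/-- The logarithmic derivative, in the direction `(τ, v)`, of the product of the powers of the
factors with exponents `e` and of the exponential factors. -/
def logDerivative (J : PType) (e : Factor m → ℂ) (t : ℂ) (u : Fin m → ℂ) (τ : ℂ)
    (v : Fin m → ℂ) : ℂ :=
  ∑ f, e f * (factorSlope τ v f * (factorValue t u f)⁻¹) +
    ∑ i, (masterExpT J (u i) * τ + masterExpU J t (u i) * v i)

lemma ne_zero_of_mem_configSpace {t : ℂ} {u : Fin m → ℂ} (hu : u ∈ configSpace J P m t)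
    (i : Fin m) (hJ : J = .III) : u i ≠ 0 := by
  simpa [factorValue] using hu (.inr (i, 0)) (Or.inr ⟨hJ, i, rfl⟩)

/-! ### Functions of moderate growth -/

lemma one_le_growth (t : ℂ) (u : Fin m → ℂ) : 1 ≤ growth J P t u := by
  unfold growth
  have : 0 ≤ ∑ f : Factor m, open Classical in
      if IsSingular J P f then ‖factorValue t u f‖⁻¹ else 0 :=
    Finset.sum_nonneg fun f _ => by split_ifs <;> positivity
  have := norm_nonneg u
  linarith

/-- Continuous functions on the configuration spaces that are bounded by a power of `growth`,
uniformly for times in `K`. -/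
structure ModerateOn (J : PType) (P : Params) (K : Set ℂ) (G : ℂ → (Fin m → ℂ) → ℂ) : Prop where
  continuousOn : ∀ t ∈ K, ContinuousOn (G t) (configSpace J P m t)
  bound : ∃ (C : ℝ) (N : ℕ), 0 ≤ C ∧ ∀ t ∈ K, ∀ u ∈ configSpace J P m t,
    ‖G t u‖ ≤ C * growth J P t u ^ N

namespace ModerateOn

variable {K : Set ℂ} {G H : ℂ → (Fin m → ℂ) → ℂ}

lemma congr (hG : ModerateOn J P K G)
    (h : ∀ t ∈ K, ∀ u ∈ configSpace J P m t, H t u = G t u) : ModerateOn J P K H := by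
  obtain ⟨C, N, hC, hb⟩ := hG.bound
  exact ⟨fun t ht => (hG.continuousOn t ht).congr (h t ht), C, N, hC, fun t ht u hu => by
    rw [h t ht u hu]; exact hb t ht u hu⟩

lemma of_bound (C : ℝ) (hc : ∀ t ∈ K, ContinuousOn (G t) (configSpace J P m t))
    (h : ∀ t ∈ K, ∀ u ∈ configSpace J P m t, ‖G t u‖ ≤ C * growth J P t u) :
    ModerateOn J P K G := by
  refine ⟨hc, max C 0, 1, le_max_right _ _, fun t ht u hu => (h t ht u hu).trans ?_⟩
  rw [pow_one]
  exact mul_le_mul_of_nonneg_right (le_max_left _ _) (zero_le_one.trans (one_le_growth t u))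

lemma const (c : ℂ) : ModerateOn J P K fun _ (_ : Fin m → ℂ) => c :=
  of_bound ‖c‖ (fun _ _ => continuousOn_const) fun t _ u _ =>
    le_mul_of_one_le_right (norm_nonneg _) (one_le_growth t u)

lemma time (hK : Bornology.IsBounded K) : ModerateOn J P K fun t (_ : Fin m → ℂ) => t := by
  obtain ⟨C, hC⟩ := hK.exists_norm_le
  refine of_bound (max C 0) (fun _ _ => continuousOn_const) fun t ht u _ => ?_
  exact ((hC t ht).trans (le_max_left _ _)).trans
    (le_mul_of_one_le_right (le_max_right _ _) (one_le_growth t u))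

lemma coord (i : Fin m) : ModerateOn J P K fun _ (u : Fin m → ℂ) => u i := by
  refine of_bound 1 (fun _ _ => (continuous_apply i).continuousOn) fun t _ u _ => ?_
  have : 0 ≤ ∑ f : Factor m, open Classical in
      if IsSingular J P f then ‖factorValue t u f‖⁻¹ else 0 :=
    Finset.sum_nonneg fun f _ => by split_ifs <;> positivity
  rw [growth]
  have := norm_le_pi_norm u i
  linarith

/-- The inverse is one of the summands of `growth`. This is what makes logarithmic derivatives
moderate. -/
lemma inv_factorValue {f : Factor m} (hf : IsSingular J P f) :
    ModerateOn J P K fun t u => (factorValue t u f)⁻¹ := by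
  classical
  refine of_bound 1 (fun t _ => ContinuousOn.inv₀ ?_ fun u hu => hu f hf) fun t _ u _ => ?_
  · exact ((continuous_factorValue f).comp
      (by fun_prop : Continuous fun u => (t, u))).continuousOn
  · have := Finset.single_le_sum (s := Finset.univ) (a := f)
      (f := fun f : Factor m => if IsSingular J P f then ‖factorValue t u f‖⁻¹ else 0)
      (fun f _ => by split_ifs <;> positivity) (Finset.mem_univ f)
    rw [if_pos hf] at this
    rw [norm_inv, one_mul, growth]
    have := norm_nonneg u
    convert (by linarith : ‖factorValue t u f‖⁻¹ ≤ 1 + ‖u‖ +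
      ∑ f : Factor m, if IsSingular J P f then ‖factorValue t u f‖⁻¹ else 0)

lemma add (hG : ModerateOn J P K G) (hH : ModerateOn J P K H) :
    ModerateOn J P K fun t u => G t u + H t u := by
  obtain ⟨C, N, hC, hb⟩ := hG.bound
  obtain ⟨C', N', hC', hb'⟩ := hH.bound
  refine ⟨fun t ht => (hG.continuousOn t ht).add (hH.continuousOn t ht), C + C', N + N',
    by positivity, fun t ht u hu => ?_⟩
  have h1 := one_le_growth (J := J) (P := P) t u
  have h2 := pow_le_pow_right₀ h1 (Nat.le_add_right N N')
  have h3 := pow_le_pow_right₀ h1 (Nat.le_add_left N' N)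
  calc ‖G t u + H t u‖ ≤ C * growth J P t u ^ N + C' * growth J P t u ^ N' :=
        (norm_add_le _ _).trans (add_le_add (hb t ht u hu) (hb' t ht u hu))
    _ ≤ C * growth J P t u ^ (N + N') + C' * growth J P t u ^ (N + N') := by gcongr
    _ = _ := by ring

lemma mul (hG : ModerateOn J P K G) (hH : ModerateOn J P K H) :
    ModerateOn J P K fun t u => G t u * H t u := by
  obtain ⟨C, N, hC, hb⟩ := hG.bound
  obtain ⟨C', N', hC', hb'⟩ := hH.bound
  refine ⟨fun t ht => (hG.continuousOn t ht).mul (hH.continuousOn t ht), C * C', N + N',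
    by positivity, fun t ht u hu => ?_⟩
  have h1 := one_le_growth (J := J) (P := P) t u
  rw [norm_mul]
  calc ‖G t u‖ * ‖H t u‖ ≤ (C * growth J P t u ^ N) * (C' * growth J P t u ^ N') :=
        mul_le_mul (hb t ht u hu) (hb' t ht u hu) (norm_nonneg _) (by positivity)
    _ = _ := by ring

lemma neg (hG : ModerateOn J P K G) : ModerateOn J P K fun t u => -G t u :=
  ((const (-1)).mul hG).congr fun _ _ _ _ => by simp

lemma sub (hG : ModerateOn J P K G) (hH : ModerateOn J P K H) :
    ModerateOn J P K fun t u => G t u - H t u :=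
  (hG.add hH.neg).congr fun _ _ _ _ => by ring

lemma pow (hG : ModerateOn J P K G) (n : ℕ) : ModerateOn J P K fun t u => G t u ^ n := by
  induction n with
  | zero => simpa using const 1
  | succ n ih => exact (ih.mul hG).congr fun _ _ _ _ => pow_succ _ _

lemma sum {α : Type*} (s : Finset α) {F : α → ℂ → (Fin m → ℂ) → ℂ}
    (hF : ∀ a ∈ s, ModerateOn J P K (F a)) : ModerateOn J P K fun t u => ∑ a ∈ s, F a t u := by
  classical
  induction s using Finset.induction_on with
  | empty => simpa using const 0
  | insert a s ha ih =>
    simp_rw [Finset.sum_insert ha]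
    exact (hF a (Finset.mem_insert_self a s)).add
      (ih fun b hb => hF b (Finset.mem_insert_of_mem hb))

lemma prod {α : Type*} (s : Finset α) {F : α → ℂ → (Fin m → ℂ) → ℂ}
    (hF : ∀ a ∈ s, ModerateOn J P K (F a)) : ModerateOn J P K fun t u => ∏ a ∈ s, F a t u := by
  classical
  induction s using Finset.induction_on with
  | empty => simpa using const 1
  | insert a s ha ih =>
    simp_rw [Finset.prod_insert ha]
    exact (hF a (Finset.mem_insert_self a s)).mul
      (ih fun b hb => hF b (Finset.mem_insert_of_mem hb))

lemma factorValue (hK : Bornology.IsBounded K) (f : Factor m) :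
    ModerateOn J P K fun t u => factorValue t u f := by
  rcases f with q | ⟨i, k⟩
  · exact (coord _).sub (coord _)
  · fin_cases k
    · exact coord i
    · exact (const 1).sub (coord i)
    · exact (time hK).sub (coord i)

lemma polyPart (hK : Bornology.IsBounded K) : ModerateOn J P K (polyPart (m := m) J P) :=
  (prod Finset.univ fun f _ => (factorValue hK f).pow (natExp J P f)).congr
    fun t _ u _ => polyPart_eq_prod t u

lemma polyDeriv (hK : Bornology.IsBounded K) (τ : ℂ) (v : Fin m → ℂ) :
    ModerateOn J P K fun t u => polyDeriv J P t u τ v :=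
  sum _ fun f _ => (prod _ fun g _ => (factorValue hK g).pow _).mul
    (((const _).mul ((factorValue hK f).pow _)).mul (const _))

lemma logDerivative (hK : Bornology.IsBounded K) (τ : ℂ) (v : Fin m → ℂ) :
    ModerateOn J P K fun t u => logDerivative J (singExp J P) t u τ v := by
  -- The derivatives of `t / u - u` have poles at `u = 0`; they are moderate because type III always
  -- counts `u_i = 0` as singular.
  have hinv (i : Fin m) (hJ : J = .III) : ModerateOn J P K fun _ (u : Fin m → ℂ) => (u i)⁻¹ :=
    (inv_factorValue (f := .inr (i, 0)) (Or.inr ⟨hJ, i, rfl⟩)).congr fun _ _ _ _ => rfl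
  refine (sum _ fun f _ => ?_).add (sum _ fun i _ =>
    ((?_ : ModerateOn J P K fun t u => masterExpT J (u i)).mul (const _)).add
    ((?_ : ModerateOn J P K fun t u => masterExpU J t (u i)).mul (const _)))
  · by_cases hf : IsSingular J P f
    · exact (const _).mul ((const _).mul (inv_factorValue hf))
    · simpa [singExp, hf] using const 0
  · cases J
    · exact (coord i).neg
    · exact hinv i rfl
    · exact (coord i).neg
    · exact coord i
    · exact const 0
  · cases J
    · exact ((time hK).add ((const 2).mul ((coord i).pow 2))).neg
    · exact ((time hK).neg.mul ((hinv i rfl).pow 2)).sub (const 1)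
    · exact (time hK).neg.add (coord i)
    · exact time hK
    · exact const 0

end ModerateOn

/-! ### Divergence-free cofactors -/

section Piola

variable {n : ℕ}

/-- The determinant is multilinear in the rows, so its derivative is a sum with one row
differentiated at a time. -/
lemma hasFDerivAt_det {E : Type*} [NormedAddCommGroup E] [NormedSpace ℝ E]
    {M : E → Matrix (Fin n) (Fin n) ℂ} {M' : Fin n → Fin n → E →L[ℝ] ℂ} {x : E}
    (h : ∀ i j, HasFDerivAt (fun p => M p i j) (M' i j) x) :
    ∃ L : E →L[ℝ] ℂ, HasFDerivAt (fun p => (M p).det) L x ∧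
      ∀ v, L v = ∑ i, ((M x).updateRow i fun j => M' i j v).det := by
  let D : ContinuousMultilinearMap ℂ (fun _ : Fin n => Fin n → ℂ) ℂ :=
    { (Matrix.detRowAlternating (R := ℂ) (n := Fin n)).toMultilinearMap with
      cont := Continuous.matrix_det (A := fun M : Fin n → Fin n → ℂ => Matrix.of M)
        continuous_id }
  have hD : ∀ A : Matrix (Fin n) (Fin n) ℂ, D A = A.det := fun _ => rfl
  have hM : HasFDerivAt (fun p i j => M p i j)
      (ContinuousLinearMap.pi fun i => ContinuousLinearMap.pi fun j => M' i j) x :=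
    hasFDerivAt_pi.2 fun i => hasFDerivAt_pi.2 fun j => h i j
  refine ⟨_, ((D.hasFDerivAt (M x)).restrictScalars ℝ).comp x hM, fun v => ?_⟩
  exact D.linearDeriv_apply (M x) fun i j => M' i j v

lemma det_updateRow_eq_sum_adjugate (A : Matrix (Fin n) (Fin n) ℂ) (k : Fin n) (v : Fin n → ℂ) :
    (A.updateRow k v).det = ∑ j, v j * A.adjugate j k := by
  rw [Matrix.det_eq_sum_mul_adjugate_row _ k]
  simp [Matrix.adjugate_apply]

/-- The derivative of the cofactor row `k` of a Jacobian matrix has zero trace. -/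
lemma sum_det_updateRow_updateRow_eq_zero (A : Matrix (Fin n) (Fin n) ℂ) {i k : Fin n}
    (hik : i ≠ k) (H : Fin n → Fin n → ℂ) (hH : ∀ j l, H j l = H l j) :
    ∑ j, ((A.updateRow k (Pi.single j 1)).updateRow i (H j)).det = 0 := by
  have h1 (j : Fin n) : ((A.updateRow k (Pi.single j 1)).updateRow i (H j)).det =
      ∑ l, H j l * ((A.updateRow k (Pi.single j 1)).updateRow i (Pi.single l 1)).det := by
    rw [det_updateRow_eq_sum_adjugate]
    simp [Matrix.adjugate_apply]
  -- Exchanging the rows `i` and `k` makes this minor antisymmetric in `j` and `l`; contracted with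
  -- the symmetric `H` it gives zero.
  have h2 (j l : Fin n) : ((A.updateRow k (Pi.single j 1)).updateRow i (Pi.single l 1)).det =
      -((A.updateRow k (Pi.single l 1)).updateRow i (Pi.single j 1)).det := by
    have h := (Matrix.detRowAlternating (R := ℂ) (n := Fin n)).map_swap
      ((A.updateRow k (Pi.single l 1)).updateRow i (Pi.single j 1)) hik
    refine Eq.trans (congrArg Matrix.det ?_) h
    ext a b
    change _ = ((A.updateRow k (Pi.single l 1)).updateRow i (Pi.single j 1)) (Equiv.swap i k a) b
    by_cases hai : a = i
    · subst hai; simp [Matrix.updateRow_ne hik.symm]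
    · by_cases hak : a = k
      · subst hak; simp [Matrix.updateRow_ne hai]
      · simp [Matrix.updateRow_ne hai, Matrix.updateRow_ne hak,
          Equiv.swap_apply_of_ne_of_ne hai hak]
  simp_rw [h1]
  have h3 : ∑ j, ∑ l, H j l *
      ((A.updateRow k (Pi.single j 1)).updateRow i (Pi.single l 1)).det =
      -∑ j, ∑ l, H j l *
      ((A.updateRow k (Pi.single j 1)).updateRow i (Pi.single l 1)).det := by
    conv_lhs => rw [Finset.sum_comm]
    rw [← Finset.sum_neg_distrib]
    refine Finset.sum_congr rfl fun j _ => ?_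
    rw [← Finset.sum_neg_distrib]
    refine Finset.sum_congr rfl fun l _ => ?_
    rw [h2, hH]; ring
  exact self_eq_neg.1 h3

/-- Divergence of a multiple of a cofactor row of a Jacobian matrix. -/
lemma hasFDerivAt_mul_adjugate {F : (Fin n → ℝ) → ℂ} {F' : (Fin n → ℝ) →L[ℝ] ℂ}
    {M : (Fin n → ℝ) → Matrix (Fin n) (Fin n) ℂ} {M' : Fin n → Fin n → (Fin n → ℝ) →L[ℝ] ℂ}
    {x : Fin n → ℝ} (hF : HasFDerivAt F F' x)
    (hM : ∀ i j, HasFDerivAt (fun p => M p i j) (M' i j) x)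
    (hsymm : ∀ i j l, M' i l (Pi.single j 1) = M' i j (Pi.single l 1))
    (c : Fin n → ℂ) (hc : ∀ j, F' (Pi.single j 1) = ∑ l, c l * M x l j) (k : Fin n) :
    ∃ L : Fin n → (Fin n → ℝ) →L[ℝ] ℂ,
      (∀ j, HasFDerivAt (fun p => F p * (M p).adjugate j k) (L j) x) ∧
      ∑ j, L j (Pi.single j 1) = c k * (M x).det := by
  have hadj (j : Fin n) : ∃ L : (Fin n → ℝ) →L[ℝ] ℂ,
      HasFDerivAt (fun p => (M p).adjugate j k) L x ∧ ∀ v, L v = ∑ i,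
        (((M x).updateRow k (Pi.single j 1)).updateRow i
          fun l => if i = k then 0 else M' i l v).det := by
    have h (i l : Fin n) : HasFDerivAt (fun p => ((M p).updateRow k (Pi.single j 1)) i l)
        (if i = k then 0 else M' i l) x := by
      by_cases hik : i = k
      · subst hik
        simpa using hasFDerivAt_const _ _
      · simpa [Matrix.updateRow_ne hik, hik] using hM i l
    obtain ⟨L, hL, hL'⟩ := hasFDerivAt_det h
    refine ⟨L, by simpa only [Matrix.adjugate_apply] using hL, fun v => ?_⟩
    rw [hL']
    congr! 4 with i _ l
    split_ifs <;> simp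
  choose L hL hL' using hadj
  refine ⟨_, fun j => hF.mul (hL j), ?_⟩
  simp only [add_apply, smul_apply, smul_eq_mul, hL', hc]
  rw [Finset.sum_add_distrib, ← Finset.mul_sum,
    Finset.sum_comm (s := Finset.univ) (t := Finset.univ)]
  -- The Piola identity: the derivatives of the cofactors drop out. What remains is `∑ j, M l j *
  -- adj j k`, which is `det M` for `l = k` and zero otherwise.
  have h0 : ∀ i, ∑ j, (((M x).updateRow k (Pi.single j 1)).updateRow i
      fun l => if i = k then 0 else M' i l (Pi.single j 1)).det = 0 := by
    intro i
    by_cases hik : i = k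
    · refine Finset.sum_eq_zero fun j _ => Matrix.det_eq_zero_of_row_eq_zero i fun l => ?_
      simp [hik]
    · simp only [if_neg hik]
      exact sum_det_updateRow_updateRow_eq_zero (M x) hik
        (fun j l => M' i l (Pi.single j 1)) fun j l => hsymm i j l
  rw [Finset.sum_eq_zero fun i _ => h0 i, mul_zero, zero_add]
  have h1 := det_updateRow_eq_sum_adjugate (M x) k (∑ l, c l • M x l)
  rw [Matrix.det_updateRow_sum] at h1
  rw [← smul_eq_mul, h1]
  refine Finset.sum_congr rfl fun j _ => ?_
  simp [mul_comm]

end Piola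

/-! ### Sections of the local system -/

section Logarithm

/-- By continuity the imaginary part of `l y - l x` stays in `(-π, π)` near `x`, where the principal
logarithm inverts the exponential. -/
lemma eventuallyEq_log_of_exp {E : Type*} [TopologicalSpace E] {l : E → ℂ} {s : Set E} {x : E}
    (hl : ContinuousWithinAt l s x) :
    l =ᶠ[𝓝[s] x] fun y => Complex.log (Complex.exp (l y) * (Complex.exp (l x))⁻¹) + l x := by
  have h : Tendsto (fun y => (l y - l x).im) (𝓝[s] x) (𝓝 0) := by
    have : Tendsto (fun y => (l y - l x).im) (𝓝[s] x) (𝓝 (l x - l x).im) :=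
      (Complex.continuous_im.tendsto _).comp (hl.sub continuousWithinAt_const)
    simpa using this
  filter_upwards [h.eventually (Ioo_mem_nhds (neg_lt_zero.2 Real.pi_pos) Real.pi_pos)] with y hy
  rw [← Complex.exp_neg, ← Complex.exp_add, ← sub_eq_add_neg, Complex.log_exp hy.1 hy.2.le]
  ring

/-- A continuous logarithm of a differentiable function is differentiable. -/
lemma hasFDerivWithinAt_of_exp {𝕜 E : Type*} [RCLike 𝕜] [NormedAddCommGroup E] [NormedSpace 𝕜 E]
    [NormedAlgebra 𝕜 ℂ]
    {l g : E → ℂ} {s : Set E} {x : E} (hx : x ∈ s) (hl : ContinuousWithinAt l s x)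
    (hlg : ∀ y ∈ s, Complex.exp (l y) = g y) {g' : E →L[𝕜] ℂ} (hg : HasFDerivWithinAt g g' s x) :
    HasFDerivWithinAt l ((g x)⁻¹ • g') s x := by
  have hg0 : g x ≠ 0 := hlg x hx ▸ Complex.exp_ne_zero _
  have h1 : g x * (g x)⁻¹ = 1 := mul_inv_cancel₀ hg0
  have hlog : HasFDerivAt Complex.log ((1 : ℂ →L[ℂ] ℂ).restrictScalars 𝕜)
      (g x * (g x)⁻¹) := by
    have := (Complex.hasDerivAt_log (z := g x * (g x)⁻¹) (by rw [h1]; simp)).hasFDerivAt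
    refine HasFDerivAt.restrictScalars 𝕜 (this.congr_fderiv ?_)
    ext; simp [h1]
  have h2 := (hlog.comp_hasFDerivWithinAt x (hg.mul_const (g x)⁻¹)).add_const (l x)
  have h3 : l =ᶠ[𝓝[s] x] fun y => (Complex.log ∘ fun y => g y * (g x)⁻¹) y + l x := by
    filter_upwards [eventuallyEq_log_of_exp hl, self_mem_nhdsWithin] with y hy hys
    rw [hy, hlg y hys, hlg x hx]; rfl
  refine (h2.congr_of_eventuallyEq h3 (h3.eq_of_nhdsWithin hx)).congr_fderiv ?_
  ext v
  simp

end Logarithm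

section Sections

variable {k : ℕ}

lemma uniqueDiffOn_stdCube (k : ℕ) : UniqueDiffOn ℝ (stdCube k) := by
  rw [stdCube, ← Set.pi_univ_Icc]
  exact UniqueDiffOn.univ_pi fun i => uniqueDiffOn_Icc zero_lt_one

lemma isCompact_stdCube (k : ℕ) : IsCompact (stdCube k) := isCompact_Icc

namespace TwistedCube

variable (σ : TwistedCube J P m T k)

lemma hasFDerivWithinAt_map {p : Fin k → ℝ} (hp : p ∈ stdCube k) :
    HasFDerivWithinAt σ.map (fderivWithin ℝ σ.map (stdCube k) p) (stdCube k) p :=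
  ((σ.smooth.differentiableOn (by simp)) p hp).hasFDerivWithinAt

/-- A section is given only by continuous logarithms of the factors. Their differentiability is
inherited from the factors themselves, and differentiating the exponential gives the logarithmic
derivative, in which the choice of branch is no longer visible. -/
lemma hasFDerivWithinAt_coeff {t : ℂ} (ht : t ∈ T) {p : Fin k → ℝ} (hp : p ∈ stdCube k) :
    ∃ L : (Fin k → ℝ) →L[ℝ] ℂ,
      HasFDerivWithinAt (fun p => σ.coeff p t) L (stdCube k) p ∧
      ∀ v, L v = σ.coeff p t *
        logDerivative J (singExp J P) t (σ.map p) 0 (fderivWithin ℝ σ.map (stdCube k) p v) := by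
  obtain ⟨C, l, hl, hw⟩ := σ.isSection
  have hσ := σ.hasFDerivWithinAt_map hp
  set D := fderivWithin ℝ σ.map (stdCube k) p
  have hsing (f : Factor m) (_ : f ∈ Finset.univ) : HasFDerivWithinAt
      (fun p => open Classical in
        if IsSingular J P f then factorExponent J P f * l f (p, t) else 0)
      (singExp J P f • ((factorValue t (σ.map p) f)⁻¹ •
        ((factorSlopeCLM f).restrictScalars ℝ ∘L D))) (stdCube k) p := by
    by_cases hf : IsSingular J P f
    · simp only [hf, if_true, singExp]
      refine HasFDerivWithinAt.const_mul (hasFDerivWithinAt_of_exp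
        (g := fun p => factorValue t (σ.map p) f) hp ?_ (fun q hq => (hl f hf).2 q hq t ht) ?_) _
      · exact (hl f hf).1.comp (f := fun p => (p, t)) (s := stdCube k) (by fun_prop)
          (fun q hq => ⟨hq, ht⟩) p hp
      · exact ((hasFDerivAt_factorValue f t (σ.map p)).restrictScalars ℝ).comp_hasFDerivWithinAt
          p hσ
    · simp only [hf, if_false, singExp]
      exact (hasFDerivWithinAt_const (0 : ℂ) p (stdCube k)).congr_fderiv (by ext v; simp)
  have hexp (i : Fin m) (_ : i ∈ Finset.univ) : HasFDerivWithinAt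
      (fun p => masterExp J t (σ.map p i))
      (masterExpU J t (σ.map p i) • (ContinuousLinearMap.proj (R := ℝ) i ∘L D))
      (stdCube k) p := by
    have h1 := (hasDerivAt_masterExp (J := J) t (σ.map p i)
      (ne_zero_of_mem_configSpace (σ.mem t ht p hp) i)).hasFDerivAt.restrictScalars ℝ
    have h2 : HasFDerivWithinAt (fun p => σ.map p i) (ContinuousLinearMap.proj (R := ℝ) i ∘L D)
      (stdCube k) p := hasFDerivWithinAt_pi'.1 hσ i
    refine (h1.comp_hasFDerivWithinAt p h2).congr_fderiv ?_
    ext v; simp [mul_comm]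
  have h := (HasFDerivWithinAt.fun_sum hsing).fun_add (HasFDerivWithinAt.fun_sum hexp)
  refine ⟨_, (h.cexp.const_mul C).congr (fun q hq => hw q hq t ht) (hw p hp t ht), fun v => ?_⟩
  rw [hw p hp t ht, smul_apply, smul_apply, smul_eq_mul, smul_eq_mul, mul_assoc]
  congr 2
  rw [add_apply, sum_apply, sum_apply, logDerivative]
  congr 1
  · refine Finset.sum_congr rfl fun f _ => ?_
    simp [mul_comm]
  · simp

lemma hasDerivAt_coeff (hT : IsOpen T) {t : ℂ} (ht : t ∈ T) {p : Fin k → ℝ}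
    (hp : p ∈ stdCube k) :
    HasDerivAt (fun t => σ.coeff p t)
      (σ.coeff p t * logDerivative J (singExp J P) t (σ.map p) 1 0) t := by
  obtain ⟨C, l, hl, hw⟩ := σ.isSection
  have hsing (f : Factor m) (_ : f ∈ Finset.univ) : HasDerivAt
      (fun t => open Classical in
        if IsSingular J P f then factorExponent J P f * l f (p, t) else 0)
      (singExp J P f * ((factorValue t (σ.map p) f)⁻¹ * factorSlope 1 0 f)) t := by
    by_cases hf : IsSingular J P f
    · simp only [hf, if_true, singExp]
      refine HasDerivAt.const_mul _ ?_
      have h := hasFDerivWithinAt_of_exp (l := fun t => l f (p, t))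
        (g := fun t => factorValue t (σ.map p) f) ht
        ((hl f hf).1.comp (f := fun t => (p, t)) (s := T) (by fun_prop)
          (fun s hs => ⟨hp, hs⟩) t ht) (fun s hs => (hl f hf).2 p hp s hs)
        (hasDerivAt_factorValue f t (σ.map p)).hasFDerivAt.hasFDerivWithinAt
      refine (h.hasFDerivAt (hT.mem_nhds ht)).hasDerivAt.congr_deriv ?_
      simp
    · simpa [hf, singExp] using hasDerivAt_const _ _
  have hexp (i : Fin m) (_ : i ∈ Finset.univ) :=
    hasDerivAt_masterExp_time (J := J) t (σ.map p i)
  have h := (HasDerivAt.fun_sum hsing).fun_add (HasDerivAt.fun_sum hexp)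
  refine ((h.cexp.const_mul C).congr_of_eventuallyEq ?_).congr_deriv ?_
  · filter_upwards [hT.mem_nhds ht] with s hs using hw p hp s hs
  · rw [hw p hp t ht, mul_assoc, logDerivative]
    simp only [mul_one, Pi.zero_apply, mul_zero, add_zero]
    simp_rw [mul_comm (factorSlope _ _ _)]

lemma continuousOn_coeff {t : ℂ} (ht : t ∈ T) :
    ContinuousOn (fun p => σ.coeff p t) (stdCube k) := fun p hp => by
  obtain ⟨L, hL, -⟩ := σ.hasFDerivWithinAt_coeff ht hp
  exact hL.continuousWithinAt

lemma continuousOn_fderivWithin :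
    ContinuousOn (fderivWithin ℝ σ.map (stdCube k)) (stdCube k) :=
  σ.smooth.continuousOn_fderivWithin (uniqueDiffOn_stdCube k) (by simp)

end TwistedCube

/-! ### Bounds for Jacobian determinants -/

lemma norm_det_le {n : ℕ} {M : Matrix (Fin n) (Fin n) ℂ} {r : ℝ} (h : ∀ i j, ‖M i j‖ ≤ r) :
    ‖M.det‖ ≤ n.factorial * r ^ n := by
  rw [Matrix.det_apply]
  refine (norm_sum_le_of_le (Finset.univ (α := Equiv.Perm (Fin n))) (f := _)
    (n := fun _ => r ^ n) fun τ _ => ?_).trans ?_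
  · rw [show ‖Equiv.Perm.sign τ • ∏ i, M (τ i) i‖ = ‖∏ i, M (τ i) i‖ by
      rcases Int.units_eq_one_or (Equiv.Perm.sign τ) with h | h <;> simp [h], norm_prod]
    exact (Finset.prod_le_prod (fun _ _ => norm_nonneg _) fun i _ => h _ _).trans (by simp)
  · simp [Fintype.card_perm]

lemma norm_jacobian_le {n : ℕ} (σ : (Fin n → ℝ) → (Fin n → ℂ)) (p : Fin n → ℝ) :
    ‖jacobian σ p‖ ≤ n.factorial * (1 + ‖fderivWithin ℝ σ (stdCube n) p‖) ^ n := by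
  refine norm_det_le fun i j => ?_
  rw [Matrix.of_apply]
  refine (norm_le_pi_norm _ i).trans ((ContinuousLinearMap.le_opNorm _ _).trans ?_)
  rw [Pi.norm_single]
  simp

end Sections

/-! ### Integrals of moderate functions over twisted cycles -/

/-- The pullback to a cube of the many-valued part of the integrand times `G du_1 ⋯ du_m`. -/
def cubeIntegrand (σ : TwistedCube J P m T m) (G : ℂ → (Fin m → ℂ) → ℂ) (t : ℂ)
    (p : Fin m → ℝ) : ℂ :=
  σ.coeff p t * G t (σ.map p) * jacobian σ.map p

/-- The integral of the many-valued part of the integrand times `G` over a twisted cycle. -/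
def cycleIntegral (Γ : TwistedCycle J P m T ι) (G : ℂ → (Fin m → ℂ) → ℂ) (t : ℂ) : ℂ :=
  ∑' s, ∫ p in stdCube m, cubeIntegrand (Γ.cube s) G t p

lemma volume_stdCube (k : ℕ) : volume (stdCube k) = 1 := by
  rw [stdCube, Real.volume_Icc_pi]; simp

lemma measurableSet_stdCube (k : ℕ) : MeasurableSet (stdCube k) := measurableSet_Icc

section Cube

variable (σ : TwistedCube J P m T m) {G H : ℂ → (Fin m → ℂ) → ℂ} {K : Set ℂ} {t : ℂ}

lemma continuousOn_jacobian : ContinuousOn (jacobian σ.map) (stdCube m) := by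
  refine (continuous_id.matrix_det (A := fun M : Matrix (Fin m) (Fin m) ℂ => M)).comp_continuousOn
    (continuousOn_pi.2 fun i => continuousOn_pi.2 fun j => ?_)
  exact (continuous_apply i).comp_continuousOn
    (σ.continuousOn_fderivWithin.clm_apply continuousOn_const)

lemma continuousOn_comp_map (ht : t ∈ T) {g : (Fin m → ℂ) → ℂ}
    (hg : ContinuousOn g (configSpace J P m t)) :
    ContinuousOn (fun p => g (σ.map p)) (stdCube m) :=
  hg.comp σ.smooth.continuousOn fun p hp => σ.mem t ht p hp

lemma continuousOn_cubeIntegrand (ht : t ∈ T) (hG : ModerateOn J P {t} G) :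
    ContinuousOn (cubeIntegrand σ G t) (stdCube m) :=
  ((σ.continuousOn_coeff ht).mul (continuousOn_comp_map σ ht (hG.continuousOn t rfl))).mul
    (continuousOn_jacobian σ)

lemma integrableOn_cubeIntegrand (ht : t ∈ T) (hG : ModerateOn J P {t} G) :
    IntegrableOn (cubeIntegrand σ G t) (stdCube m) :=
  (continuousOn_cubeIntegrand σ ht hG).integrableOn_compact (isCompact_stdCube m)

end Cube

/-! ### Convergence, linearity and time derivative of integrals over cycles -/

section Integral

variable (Γ : TwistedCycle J P m T ι) {G H : ℂ → (Fin m → ℂ) → ℂ} {K : Set ℂ} {t : ℂ}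

/-- Rapid decay is used with the growth exponent of `G` as `N`. The power of the derivative is kept
in the bound so that it controls both the full Jacobian and its minors on the faces. -/
lemma exists_coeff_mul_le (hK : IsCompact K) (hKT : K ⊆ T) (hG : ModerateOn J P K G) :
    ∃ B : ι → ℝ, Summable B ∧ ∀ s, ∀ t ∈ K, ∀ p ∈ stdCube m,
      ‖(Γ.cube s).coeff p t * G t ((Γ.cube s).map p)‖ *
        (1 + ‖fderivWithin ℝ (Γ.cube s).map (stdCube m) p‖) ^ m ≤ B s := by
  obtain ⟨C, N, hC, hb⟩ := hG.bound
  obtain ⟨B, hB, hB'⟩ := Γ.rapidDecay K hKT hK N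
  refine ⟨fun s => C * B s, hB.mul_left C, fun s t ht p hp => ?_⟩
  refine le_trans ?_ (mul_le_mul_of_nonneg_left (hB' s t ht p hp) hC)
  rw [norm_mul]
  calc _ ≤ ‖(Γ.cube s).coeff p t‖ * (C * growth J P t ((Γ.cube s).map p) ^ N) *
        (1 + ‖fderivWithin ℝ (Γ.cube s).map (stdCube m) p‖) ^ m := by
        gcongr
        exact hb t ht _ ((Γ.cube s).mem t (hKT ht) p hp)
    _ = _ := by ring

lemma exists_cubeIntegrand_le (hK : IsCompact K) (hKT : K ⊆ T) (hG : ModerateOn J P K G) :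
    ∃ B : ι → ℝ, Summable B ∧ ∀ s, ∀ t ∈ K, ∀ p ∈ stdCube m,
      ‖cubeIntegrand (Γ.cube s) G t p‖ ≤ B s := by
  obtain ⟨B, hB, hB'⟩ := exists_coeff_mul_le Γ hK hKT hG
  refine ⟨fun s => m.factorial * B s, hB.mul_left _, fun s t ht p hp => ?_⟩
  refine le_trans ?_ (mul_le_mul_of_nonneg_left (hB' s t ht p hp) (Nat.cast_nonneg _))
  rw [cubeIntegrand, norm_mul]
  calc _ ≤ ‖(Γ.cube s).coeff p t * G t ((Γ.cube s).map p)‖ * (m.factorial *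
        (1 + ‖fderivWithin ℝ (Γ.cube s).map (stdCube m) p‖) ^ m) := by
        gcongr
        exact norm_jacobian_le _ _
    _ = _ := by ring

lemma norm_integral_stdCube_le {k : ℕ} {E : Type*} [NormedAddCommGroup E] [NormedSpace ℝ E]
    {f : (Fin k → ℝ) → E} {B : ℝ}
    (h : ∀ p ∈ stdCube k, ‖f p‖ ≤ B) : ‖∫ p in stdCube k, f p‖ ≤ B := by
  have := norm_setIntegral_le_of_norm_le_const (μ := volume) (by simp [volume_stdCube]) h
  simpa [Measure.real, volume_stdCube] using this

lemma summable_integral_norm (ht : t ∈ T) (hG : ModerateOn J P {t} G) :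
    Summable fun s => ∫ p in stdCube m, ‖cubeIntegrand (Γ.cube s) G t p‖ := by
  obtain ⟨B, hB, hB'⟩ :=
    exists_cubeIntegrand_le Γ isCompact_singleton (singleton_subset_iff.2 ht) hG
  refine Summable.of_norm_bounded hB fun s => norm_integral_stdCube_le fun p hp => ?_
  simpa using hB' s t rfl p hp

lemma summable_integral (ht : t ∈ T) (hG : ModerateOn J P {t} G) :
    Summable fun s => ∫ p in stdCube m, cubeIntegrand (Γ.cube s) G t p :=
  Summable.of_norm_bounded (summable_integral_norm Γ ht hG) fun _ =>
    norm_integral_le_integral_norm _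

lemma cycleIntegral_congr (ht : t ∈ T) (h : ∀ u ∈ configSpace J P m t, G t u = H t u) :
    cycleIntegral Γ G t = cycleIntegral Γ H t := by
  refine tsum_congr fun s => setIntegral_congr_fun (measurableSet_stdCube m) fun p hp => ?_
  simp only [cubeIntegrand]
  rw [h _ ((Γ.cube s).mem t ht p hp)]

lemma cycleIntegral_add (ht : t ∈ T) (hG : ModerateOn J P {t} G) (hH : ModerateOn J P {t} H) :
    cycleIntegral Γ (fun t u => G t u + H t u) t = cycleIntegral Γ G t + cycleIntegral Γ H t := by
  rw [cycleIntegral, cycleIntegral, cycleIntegral,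
    ← (summable_integral Γ ht hG).tsum_add (summable_integral Γ ht hH)]
  refine tsum_congr fun s => ?_
  rw [← integral_add (integrableOn_cubeIntegrand _ ht hG) (integrableOn_cubeIntegrand _ ht hH)]
  simp only [cubeIntegrand]
  congr! 2
  ring

lemma cycleIntegral_const_mul (c : ℂ) :
    cycleIntegral Γ (fun t u => c * G t u) t = c * cycleIntegral Γ G t := by
  rw [cycleIntegral, cycleIntegral, ← tsum_mul_left]
  refine tsum_congr fun s => ?_
  rw [← integral_const_mul]
  simp only [cubeIntegrand]
  congr! 2
  ring

lemma cycleIntegral_sum (ht : t ∈ T) {α : Type*} (s : Finset α)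
    {F : α → ℂ → (Fin m → ℂ) → ℂ} (hF : ∀ a ∈ s, ModerateOn J P {t} (F a)) :
    cycleIntegral Γ (fun t u => ∑ a ∈ s, F a t u) t = ∑ a ∈ s, cycleIntegral Γ (F a) t := by
  classical
  induction s using Finset.induction_on with
  | empty => simp [cycleIntegral, cubeIntegrand]
  | insert a s ha ih =>
    simp_rw [Finset.sum_insert ha]
    rw [cycleIntegral_add Γ ht (hF a (Finset.mem_insert_self a s))
      (.sum s fun b hb => hF b (Finset.mem_insert_of_mem hb)),
      ih fun b hb => hF b (Finset.mem_insert_of_mem hb)]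

/-- Differentiation with respect to the time under the integral sign. -/
lemma hasDerivAt_cycleIntegral (hT : IsOpen T) (ht : t ∈ T)
    (hG : ∀ K ⊆ T, IsCompact K → ModerateOn J P K G)
    (hH : ∀ K ⊆ T, IsCompact K → ModerateOn J P K H)
    (hGH : ∀ t u, HasDerivAt (fun t => G t u) (H t u) t) :
    HasDerivAt (cycleIntegral Γ G)
      (cycleIntegral Γ (fun t u => logDerivative J (singExp J P) t u 1 0 * G t u + H t u) t) t := by
  obtain ⟨r, hr, hrT⟩ := Metric.nhds_basis_closedBall.mem_iff.1 (hT.mem_nhds ht)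
  have hK : IsCompact (Metric.closedBall t r) := isCompact_closedBall t r
  have hH' (K) (hK : IsCompact K) (hKT : K ⊆ T) : ModerateOn J P K
      (fun t u => logDerivative J (singExp J P) t u 1 0 * G t u + H t u) :=
    ((ModerateOn.logDerivative hK.isBounded 1 0).mul (hG K hKT hK)).add (hH K hKT hK)
  have hsing (z) (hz : z ∈ T) : {z} ⊆ T := singleton_subset_iff.2 hz
  obtain ⟨B, hB, hB'⟩ := exists_cubeIntegrand_le Γ hK hrT (hG _ hrT hK)
  -- These bounds only serve to differentiate each single integral. Their summability is not needed:
  -- a normally convergent series of holomorphic functions may be differentiated term by term.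
  obtain ⟨B₁, -, hB₁'⟩ := exists_cubeIntegrand_le Γ hK hrT (hH' _ hK hrT)
  have hball : Metric.ball t r ⊆ T := Metric.ball_subset_closedBall.trans hrT
  have hcube (s : ι) (z : ℂ) (hz : z ∈ Metric.ball t r) :
      HasDerivAt (fun z => ∫ p in stdCube m, cubeIntegrand (Γ.cube s) G z p)
        (∫ p in stdCube m, cubeIntegrand (Γ.cube s)
          (fun t u => logDerivative J (singExp J P) t u 1 0 * G t u + H t u) z p) z := by
    have hzT := hball hz
    refine (hasDerivAt_integral_of_dominated_loc_of_deriv_le (bound := fun _ => B₁ s)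
      (Metric.isOpen_ball.mem_nhds hz) ?_ ?_ ?_ ?_ ?_ ?_).2
    · filter_upwards [Metric.isOpen_ball.mem_nhds hz] with y hy
      exact (integrableOn_cubeIntegrand _ (hball hy)
        (hG _ (hsing y (hball hy)) isCompact_singleton)).aestronglyMeasurable
    · exact integrableOn_cubeIntegrand _ hzT (hG _ (hsing z hzT) isCompact_singleton)
    · exact (integrableOn_cubeIntegrand _ hzT
        (hH' _ isCompact_singleton (hsing z hzT))).aestronglyMeasurable
    · filter_upwards [ae_restrict_mem (measurableSet_stdCube m)] with p hp y hy
      exact hB₁' s y (Metric.ball_subset_closedBall hy) p hp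
    · exact integrableOn_const (by simp [volume_stdCube])
    · filter_upwards [ae_restrict_mem (measurableSet_stdCube m)] with p hp y hy
      have h := (((Γ.cube s).hasDerivAt_coeff hT (hball hy) hp).fun_mul
        (hGH y ((Γ.cube s).map p))).mul_const (jacobian (Γ.cube s).map p)
      refine h.congr_deriv ?_
      simp only [cubeIntegrand]
      ring
  have hdiff (s : ι) : DifferentiableOn ℂ
      (fun z => ∫ p in stdCube m, cubeIntegrand (Γ.cube s) G z p) (Metric.ball t r) :=
    fun z hz => (hcube s z hz).differentiableAt.differentiableWithinAt
  have hle (s : ι) (z : ℂ) (hz : z ∈ Metric.ball t r) :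
      ‖∫ p in stdCube m, cubeIntegrand (Γ.cube s) G z p‖ ≤ B s :=
    norm_integral_stdCube_le fun p hp => hB' s z (Metric.ball_subset_closedBall hz) p hp
  have htb := Metric.mem_ball_self (x := t) hr
  have h1 := Complex.differentiableOn_tsum_of_summable_norm hB hdiff Metric.isOpen_ball hle
  have h2 := Complex.hasSum_deriv_of_summable_norm hB hdiff Metric.isOpen_ball hle htb
  refine ((h1 t htb).differentiableAt (Metric.isOpen_ball.mem_nhds htb)).hasDerivAt.congr_deriv ?_
  rw [← h2.tsum_eq]
  exact tsum_congr fun s => (hcube s t htb).deriv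

end Integral

/-! ### The theorem of Stokes for twisted cycles -/

section Face

variable {n : ℕ}

lemma facePoint_mem_stdCube (i : Fin (n + 1)) (ε : Bool) {p : Fin n → ℝ} (hp : p ∈ stdCube n) :
    facePoint i ε p ∈ stdCube (n + 1) := by
  constructor <;> intro j <;> refine Fin.succAboveCases i ?_ (fun a => ?_) j
  · cases ε <;> simp [facePoint]
  · simpa [facePoint] using hp.1 a
  · cases ε <;> simp [facePoint]
  · simpa [facePoint] using hp.2 a

lemma hasFDerivAt_facePoint (i : Fin (n + 1)) (ε : Bool) (p : Fin n → ℝ) :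
    ∃ L : (Fin n → ℝ) →L[ℝ] (Fin (n + 1) → ℝ), HasFDerivAt (facePoint i ε) L p ∧
      ∀ b, L (Pi.single b 1) = Pi.single (i.succAbove b) 1 := by
  refine ⟨ContinuousLinearMap.pi (Fin.insertNth (α := fun _ => (Fin n → ℝ) →L[ℝ] ℝ) i 0
    fun a => ContinuousLinearMap.proj a), hasFDerivAt_pi.2 fun j => ?_, fun b => ?_⟩
  · refine Fin.succAboveCases i ?_ (fun a => ?_) j
    · simpa [facePoint] using hasFDerivAt_const _ _
    · simpa [facePoint] using hasFDerivAt_apply a p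
  · ext j
    refine Fin.succAboveCases i ?_ (fun a => ?_) j
    · simp [(Fin.succAbove_ne i b).symm]
    · simp [Pi.single_apply]

lemma continuous_facePoint (i : Fin (n + 1)) (ε : Bool) :
    Continuous (facePoint (n := n) i ε) := by
  refine continuous_iff_continuousAt.2 fun p => ?_
  obtain ⟨L, hL, -⟩ := hasFDerivAt_facePoint i ε p
  exact hL.continuousAt

/-- The coefficient of `du_1 ⋯ du_{k-1} du_{k+1} ⋯` in the pullback by `τ`. -/
def minorJacobian (k : Fin (n + 1)) (τ : (Fin n → ℝ) → (Fin (n + 1) → ℂ)) (p : Fin n → ℝ) : ℂ :=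
  (Matrix.of fun a b : Fin n =>
    fderivWithin ℝ τ (stdCube n) p (Pi.single b 1) (k.succAbove a)).det

lemma minorJacobian_congr (k : Fin (n + 1)) {τ τ' : (Fin n → ℝ) → (Fin (n + 1) → ℂ)}
    (h : EqOn τ τ' (stdCube n)) {p : Fin n → ℝ} (hp : p ∈ stdCube n) :
    minorJacobian k τ p = minorJacobian k τ' p := by
  rw [minorJacobian, minorJacobian, fderivWithin_congr h (h hp)]

/-- The column of the direction on which the cube does not depend is zero. At the boundary of the
cube this derivative is one-sided, hence the comparison of derivatives within `[0,1]`. -/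
lemma minorJacobian_of_isDegenerate (k : Fin (n + 1)) {τ : (Fin n → ℝ) → (Fin (n + 1) → ℂ)}
    (hτ : IsDegenerate τ) {p : Fin n → ℝ} (hp : p ∈ stdCube n)
    (hd : DifferentiableWithinAt ℝ τ (stdCube n) p) : minorJacobian k τ p = 0 := by
  obtain ⟨b, hb⟩ := hτ
  refine Matrix.det_eq_zero_of_column_eq_zero b fun a => ?_
  suffices h : fderivWithin ℝ τ (stdCube n) p (Pi.single b 1) = 0 by simp [h]
  have hmaps : MapsTo (Function.update p b) (Icc 0 1) (stdCube n) := fun s hs => by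
    constructor <;> intro j <;> by_cases hj : j = b
    · subst hj; simpa using hs.1
    · simpa [hj] using hp.1 j
    · subst hj; simpa using hs.2
    · simpa [hj] using hp.2 j
  have hpb : p b ∈ Icc (0 : ℝ) 1 := ⟨hp.1 b, hp.2 b⟩
  have h1 : HasDerivWithinAt (Function.update p b) (Pi.single b 1) (Icc 0 1) (p b) :=
    (hasDerivAt_update p b (p b)).hasDerivWithinAt
  have h2 : HasDerivWithinAt (τ ∘ Function.update p b)
      (fderivWithin ℝ τ (stdCube n) p (Pi.single b 1)) (Icc 0 1) (p b) := by
    refine HasFDerivWithinAt.comp_hasDerivWithinAt (p b) ?_ h1 hmaps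
    simpa using hd.hasFDerivWithinAt
  have h3 : HasDerivWithinAt (τ ∘ Function.update p b) 0 (Icc 0 1) (p b) := by
    refine (hasDerivWithinAt_const (p b) (Icc 0 1) (τ p)).congr (fun s hs => ?_) (by simp)
    exact hb _ (hmaps hs) p hp fun j hj => by simp [hj]
  exact (uniqueDiffOn_Icc zero_lt_one (p b) hpb).eq_deriv _ h2 h3

end Face

/-! ### Stokes on a single cube -/

section Cube

variable {n : ℕ} (σ : TwistedCube J P (n + 1) T (n + 1))

lemma hasFDerivWithinAt_face (i : Fin (n + 1)) (ε : Bool) {p : Fin n → ℝ} (hp : p ∈ stdCube n) :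
    ∃ L : (Fin n → ℝ) →L[ℝ] (Fin (n + 1) → ℂ),
      HasFDerivWithinAt (fun r => σ.map (facePoint i ε r)) L (stdCube n) p ∧
      ∀ b, L (Pi.single b 1) = fderivWithin ℝ σ.map (stdCube (n + 1)) (facePoint i ε p)
        (Pi.single (i.succAbove b) 1) := by
  obtain ⟨L, hL, hL'⟩ := hasFDerivAt_facePoint i ε p
  refine ⟨_, (σ.hasFDerivWithinAt_map (facePoint_mem_stdCube i ε hp)).comp p
    hL.hasFDerivWithinAt fun q hq => facePoint_mem_stdCube i ε hq, fun b => ?_⟩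
  simp [hL']

lemma minorJacobian_face (k i : Fin (n + 1)) (ε : Bool) {p : Fin n → ℝ} (hp : p ∈ stdCube n) :
    minorJacobian k (fun r => σ.map (facePoint i ε r)) p =
      ((Matrix.of fun a b => fderivWithin ℝ σ.map (stdCube (n + 1)) (facePoint i ε p)
        (Pi.single b 1) a).submatrix k.succAbove i.succAbove).det := by
  obtain ⟨L, hL, hL'⟩ := hasFDerivWithinAt_face σ i ε hp
  rw [minorJacobian, hL.fderivWithin (uniqueDiffOn_stdCube n p hp)]
  simp only [hL']
  rfl

lemma continuousOn_minorJacobian_face (k i : Fin (n + 1)) (ε : Bool) :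
    ContinuousOn (minorJacobian k fun r => σ.map (facePoint i ε r)) (stdCube n) := by
  refine ContinuousOn.congr ?_ fun p hp => minorJacobian_face σ k i ε hp
  refine (continuous_id.matrix_det (A := fun M : Matrix (Fin n) (Fin n) ℂ => M)).comp_continuousOn
    (continuousOn_pi.2 fun a => continuousOn_pi.2 fun b => ?_)
  exact (continuous_apply (k.succAbove a)).comp_continuousOn
    ((σ.continuousOn_fderivWithin.comp (continuous_facePoint i ε).continuousOn
      fun p hp => facePoint_mem_stdCube i ε hp).clm_apply continuousOn_const)

/-- The natural exponent is `n`; it is raised to `n + 1` to match the power in the decay condition.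
-/
lemma norm_minorJacobian_face_le (k i : Fin (n + 1)) (ε : Bool) {p : Fin n → ℝ}
    (hp : p ∈ stdCube n) :
    ‖minorJacobian k (fun r => σ.map (facePoint i ε r)) p‖ ≤ n.factorial *
      (1 + ‖fderivWithin ℝ σ.map (stdCube (n + 1)) (facePoint i ε p)‖) ^ (n + 1) := by
  rw [minorJacobian_face σ k i ε hp]
  refine (norm_det_le (r := 1 + ‖fderivWithin ℝ σ.map (stdCube (n + 1)) (facePoint i ε p)‖)
    fun a b => ?_).trans ?_
  · rw [Matrix.submatrix_apply, Matrix.of_apply]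
    refine (norm_le_pi_norm _ _).trans ((ContinuousLinearMap.le_opNorm _ _).trans ?_)
    rw [Pi.norm_single]
    simp
  · gcongr
    · simp
    · simp

/-- The integral over a face of the form `w g du_1 ⋯ du_{k-1} du_{k+1} ⋯`, with sign. -/
def faceIntegral (k : Fin (n + 1)) (g : (Fin (n + 1) → ℂ) → ℂ) (t : ℂ) (i : Fin (n + 1))
    (ε : Bool) : ℂ :=
  ∫ p in stdCube n, faceSign i ε * σ.coeff (facePoint i ε p) t * (g (σ.map (facePoint i ε p)) *
    minorJacobian k (fun r => σ.map (facePoint i ε r)) p)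

lemma continuousLinearMap_apply_eq_sum {m : ℕ} (L : (Fin m → ℂ) →L[ℂ] ℂ) (v : Fin m → ℂ) :
    L v = ∑ l, v l * L (Pi.single l 1) := by
  have h : v = ∑ l, v l • (Pi.single l 1 : Fin m → ℂ) := by
    ext j; simp [Pi.single_apply]
  conv_lhs => rw [h]
  simp

/-- Linearity in `v` is needed twice: for the chain rule along a cube, and to assemble the total
derivatives in the single variables `u_k`. -/
lemma logDerivative_eq_sum {m : ℕ} (e : Factor m → ℂ) (t : ℂ) (u v : Fin m → ℂ) :
    logDerivative J e t u 0 v = ∑ l, v l * logDerivative J e t u 0 (Pi.single l 1) := by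
  have h1 (f : Factor m) : factorSlope 0 v f = ∑ l, v l * factorSlope 0 (Pi.single l 1) f :=
    continuousLinearMap_apply_eq_sum (factorSlopeCLM f) v
  simp only [logDerivative, mul_zero, zero_add, mul_add, Finset.sum_add_distrib, Finset.mul_sum]
  congr 1
  · rw [Finset.sum_comm]
    refine Finset.sum_congr rfl fun f _ => ?_
    rw [h1, Finset.sum_mul, Finset.mul_sum]
    exact Finset.sum_congr rfl fun l _ => by ring
  · rw [Finset.sum_comm]
    refine Finset.sum_congr rfl fun i _ => ?_
    simp [Pi.single_apply, mul_comm]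

/-- The theorem of Stokes for one cube. -/
lemma integral_cubeIntegrand_eq_sum_faceIntegral {t : ℂ} (ht : t ∈ T) (k : Fin (n + 1))
    {g : (Fin (n + 1) → ℂ) → ℂ} {g' : (Fin (n + 1) → ℂ) → (Fin (n + 1) → ℂ) →L[ℂ] ℂ}
    (hg : ∀ u ∈ configSpace J P (n + 1) t, HasFDerivAt g (g' u) u)
    (hmodg : ModerateOn J P {t} fun _ => g)
    (hmod : ModerateOn J P {t} fun _ u => g' u (Pi.single k 1)) :
    ∫ p in stdCube (n + 1), cubeIntegrand σ (fun t u =>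
        logDerivative J (singExp J P) t u 0 (Pi.single k 1) * g u + g' u (Pi.single k 1)) t p =
      (-1) ^ (k : ℕ) * ∑ q : Fin (n + 1) × Bool, faceIntegral σ k g t q.1 q.2 := by
  have hgc : ContinuousOn g (configSpace J P (n + 1) t) :=
    fun u hu => (hg u hu).continuousAt.continuousWithinAt
  set M : (Fin (n + 1) → ℝ) → Matrix (Fin (n + 1)) (Fin (n + 1)) ℂ := fun p =>
    Matrix.of fun i j => fderivWithin ℝ σ.map (stdCube (n + 1)) p (Pi.single j 1) i with hM
  have hMc : ContinuousOn M (stdCube (n + 1)) :=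
    continuousOn_pi.2 fun i => continuousOn_pi.2 fun j =>
      (continuous_apply i).comp_continuousOn
        (σ.continuousOn_fderivWithin.clm_apply continuousOn_const)
  -- Second derivatives of the cube are taken only in the interior, which has full measure; the
  -- divergence theorem asks for continuity alone on the closed cube.
  set I : Set (Fin (n + 1) → ℝ) := pi univ fun _ => Ioo 0 1 with hI
  have hIo : IsOpen I := isOpen_set_pi finite_univ fun _ _ => isOpen_Ioo
  have hIc : I ⊆ stdCube (n + 1) := fun p hp =>
    ⟨fun i => (hp i trivial).1.le, fun i => (hp i trivial).2.le⟩
  have hkey : ∀ p ∈ I, ∃ L : Fin (n + 1) → (Fin (n + 1) → ℝ) →L[ℝ] ℂ,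
      (∀ j, HasFDerivAt (fun p => σ.coeff p t * g (σ.map p) * (M p).adjugate j k) (L j) p) ∧
      ∑ j, L j (Pi.single j 1) = cubeIntegrand σ (fun t u =>
        logDerivative J (singExp J P) t u 0 (Pi.single k 1) * g u + g' u (Pi.single k 1)) t p := by
    intro p hp
    have hpc := hIc hp
    have hnhds : stdCube (n + 1) ∈ 𝓝 p := Filter.mem_of_superset (hIo.mem_nhds hp) hIc
    obtain ⟨L, hL, hL'⟩ := σ.hasFDerivWithinAt_coeff ht hpc
    have hσ := (σ.hasFDerivWithinAt_map hpc).hasFDerivAt hnhds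
    have hgσ := ((hg _ (σ.mem t ht p hpc)).restrictScalars ℝ).comp p hσ
    have hsm : ContDiffAt ℝ ∞ σ.map p := σ.smooth.contDiffAt hnhds
    have h2 : HasFDerivAt (fderiv ℝ σ.map) (fderiv ℝ (fderiv ℝ σ.map) p) p :=
      ((hsm.fderiv_right (m := 1) (WithTop.coe_le_coe.2 le_top)).differentiableAt
        (by simp)).hasFDerivAt
    have hev : fderivWithin ℝ σ.map (stdCube (n + 1)) =ᶠ[𝓝 p] fderiv ℝ σ.map := by
      filter_upwards [hIo.mem_nhds hp] with q hq
      exact fderivWithin_of_mem_nhds (Filter.mem_of_superset (hIo.mem_nhds hq) hIc)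
    have h3 := h2.congr_of_eventuallyEq hev
    have hM' (i j : Fin (n + 1)) : HasFDerivAt (fun p => M p i j)
        ((ContinuousLinearMap.proj (R := ℝ) i) ∘L
          (ContinuousLinearMap.apply ℝ (Fin (n + 1) → ℂ) (Pi.single j 1)) ∘L
          fderiv ℝ (fderiv ℝ σ.map) p) p := by
      have := ((ContinuousLinearMap.proj (R := ℝ) (φ := fun _ : Fin (n + 1) => ℂ) i) ∘L
        (ContinuousLinearMap.apply ℝ (Fin (n + 1) → ℂ) (Pi.single j 1))).hasFDerivAt.comp p h3
      exact this
    have hsymm := hsm.isSymmSndFDerivAt (by simpa using ENat.LEInfty.out)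
    obtain ⟨L₂, hL₂, hL₂'⟩ := hasFDerivAt_mul_adjugate ((hL.hasFDerivAt hnhds).mul hgσ) hM'
      (fun i j l => by simp [hsymm.eq (Pi.single j 1) (Pi.single l 1)])
      (fun l => σ.coeff p t *
        (logDerivative J (singExp J P) t (σ.map p) 0 (Pi.single l 1) * g (σ.map p) +
          g' (σ.map p) (Pi.single l 1)))
      (fun j => by
        simp only [add_apply, smul_apply, smul_eq_mul, hL', ContinuousLinearMap.comp_apply,
          ContinuousLinearMap.coe_restrictScalars', Function.comp_apply]
        rw [logDerivative_eq_sum, continuousLinearMap_apply_eq_sum (g' _)]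
        simp only [Finset.mul_sum, ← Finset.sum_add_distrib]
        refine Finset.sum_congr rfl fun l _ => ?_
        simp only [hM, Matrix.of_apply]
        ring) k
    exact ⟨L₂, hL₂, hL₂'⟩
  choose! L hL hL' using hkey
  have hcont (j : Fin (n + 1)) : ContinuousOn
      (fun p => σ.coeff p t * g (σ.map p) * (M p).adjugate j k) (stdCube (n + 1)) := by
    refine ((σ.continuousOn_coeff ht).mul (continuousOn_comp_map σ ht hgc)).mul ?_
    exact (continuous_apply k).comp_continuousOn ((continuous_apply j).comp_continuousOn
      ((continuous_id.matrix_adjugate (A := fun M : Matrix (Fin (n + 1)) (Fin (n + 1)) ℂ =>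
        M)).comp_continuousOn hMc))
  have hmod2 : ModerateOn J P {t} fun t u =>
        logDerivative J (singExp J P) t u 0 (Pi.single k 1) * g u + g' u (Pi.single k 1) :=
    ((ModerateOn.logDerivative Bornology.isBounded_singleton 0 _).mul hmodg).add hmod
  have hae : I =ᵐ[volume] stdCube (n + 1) := Measure.univ_pi_Ioo_ae_eq_Icc
  have hint := (integrableOn_cubeIntegrand σ ht hmod2)
  have hdiv := integral_divergence_of_hasFDerivAt_off_countable' (0 : Fin (n + 1) → ℝ) 1
    zero_le_one (fun j p => σ.coeff p t * g (σ.map p) * (M p).adjugate j k)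
    (fun j p => L p j) ∅ countable_empty hcont (fun p hp j => hL p hp.1 j) ?_
  · have h1 : ∫ p in stdCube (n + 1), cubeIntegrand σ (fun t u =>
        logDerivative J (singExp J P) t u 0 (Pi.single k 1) * g u + g' u (Pi.single k 1)) t p =
        ∫ p in Icc (0 : Fin (n + 1) → ℝ) 1, ∑ j, L p j (Pi.single j 1) := by
      rw [← setIntegral_congr_set hae]
      change _ = ∫ p in stdCube (n + 1), _
      rw [← setIntegral_congr_set hae]
      exact setIntegral_congr_fun hIo.measurableSet fun p hp => (hL' p hp).symm
    rw [h1, hdiv, Fintype.sum_prod_type, Finset.mul_sum]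
    refine Finset.sum_congr rfl fun i _ => ?_
    -- The cofactor sign `(-1) ^ (k + i)` splits into the global sign `(-1) ^ k` and the part `(-1)
    -- ^ i` of `faceSign`; the rest of `faceSign` is the sign of the upper or lower face in the
    -- divergence theorem.
    have hface (ε : Bool) : (-1) ^ (k : ℕ) * faceIntegral σ k g t i ε =
        (if ε then 1 else -1) * ∫ p in stdCube n, σ.coeff (facePoint i ε p) t *
          g (σ.map (facePoint i ε p)) * (M (facePoint i ε p)).adjugate i k := by
      rw [faceIntegral, ← integral_const_mul, ← integral_const_mul]
      refine setIntegral_congr_fun (measurableSet_stdCube n) fun p hp => ?_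
      rw [minorJacobian_face σ k i ε hp, Matrix.adjugate_fin_succ_eq_det_submatrix, faceSign]
      cases ε <;> simp [pow_add] <;> ring
    rw [Finset.mul_sum, Fintype.sum_bool, hface, hface]
    simp only [if_true, Bool.false_eq_true, if_false, one_mul, neg_one_mul, ← sub_eq_add_neg]
    rfl
  · refine (hint.mono_set hIc |>.congr_fun (fun p hp => (hL' p hp).symm)
      hIo.measurableSet).congr_set_ae hae.symm

end Cube

/-! ### Cancellation of the faces of a cycle -/

section Cycle

variable {n : ℕ} (Γ : TwistedCycle J P (n + 1) T ι) {t : ℂ}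

lemma summable_faceIntegral (ht : t ∈ T) (k : Fin (n + 1)) {g : (Fin (n + 1) → ℂ) → ℂ}
    (hmod : ModerateOn J P {t} fun _ => g) :
    Summable fun q : ι × Fin (n + 1) × Bool => faceIntegral (Γ.cube q.1) k g t q.2.1 q.2.2 := by
  obtain ⟨B, hB, hB'⟩ :=
    exists_coeff_mul_le Γ isCompact_singleton (singleton_subset_iff.2 ht) hmod
  have hs : Summable fun q : ι × Fin (n + 1) × Bool => |B q.1| * (n.factorial : ℝ) :=
    hB.abs.mul_of_nonneg (g := fun _ : Fin (n + 1) × Bool => (n.factorial : ℝ))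
      (Summable.of_finite) (fun _ => abs_nonneg _) fun _ => Nat.cast_nonneg _
  refine Summable.of_norm_bounded hs fun ⟨s, i, ε⟩ => norm_integral_stdCube_le fun p hp => ?_
  have h := hB' s t rfl _ (facePoint_mem_stdCube i ε hp)
  have hsign : ‖faceSign i ε‖ = 1 := by simp [faceSign]
  rw [norm_mul] at h
  rw [norm_mul, norm_mul, norm_mul, hsign, one_mul, ← mul_assoc]
  calc _ ≤ ‖(Γ.cube s).coeff (facePoint i ε p) t‖ * ‖g ((Γ.cube s).map (facePoint i ε p))‖ *
        (n.factorial * (1 + ‖fderivWithin ℝ (Γ.cube s).map (stdCube (n + 1))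
          (facePoint i ε p)‖) ^ (n + 1)) := by
        gcongr
        exact norm_minorJacobian_face_le _ k i ε hp
    _ = (‖(Γ.cube s).coeff (facePoint i ε p) t‖ * ‖g ((Γ.cube s).map (facePoint i ε p))‖ *
        (1 + ‖fderivWithin ℝ (Γ.cube s).map (stdCube (n + 1))
          (facePoint i ε p)‖) ^ (n + 1)) * n.factorial := by ring
    _ ≤ |B s| * n.factorial := by
        gcongr
        exact h.trans (le_abs_self _)

/-- The faces that coincide with a given cube contribute nothing to the boundary integral. -/
lemma tsum_faceIntegral_eq_zero (ht : t ∈ T) (k : Fin (n + 1)) {g : (Fin (n + 1) → ℂ) → ℂ}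
    (hg : ContinuousOn g (configSpace J P (n + 1) t))
    (c : stdCube n → (Fin (n + 1) → ℂ)) :
    ∑' q : (fun q : ι × Fin (n + 1) × Bool => (stdCube n).domRestrict
      fun r => (Γ.cube q.1).map (facePoint q.2.1 q.2.2 r)) ⁻¹' {c},
      faceIntegral (Γ.cube q.1.1) k g t q.1.2.1 q.1.2.2 = 0 := by
  set F : ι × Fin (n + 1) × Bool → (Fin n → ℝ) → (Fin (n + 1) → ℂ) := fun q r =>
    (Γ.cube q.1).map (facePoint q.2.1 q.2.2 r) with hF
  rcases isEmpty_or_nonempty ((fun q => (stdCube n).domRestrict (F q)) ⁻¹' {c}) with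
    hempty | ⟨q₀, hq₀⟩
  · exact tsum_empty
  set τ := F q₀ with hτ
  have hfib : (fun q => (stdCube n).domRestrict (F q)) ⁻¹' {c} =
      {q | EqOn (F q) τ (stdCube n)} := by
    ext q
    rw [mem_preimage, mem_singleton_iff, ← mem_singleton_iff.1 hq₀]
    exact domRestrict_eq_domRestrict_iff
  rw [hfib]
  have hdiff {p : Fin n → ℝ} (hp : p ∈ stdCube n) : DifferentiableWithinAt ℝ τ (stdCube n) p := by
    obtain ⟨L, hL, -⟩ := hasFDerivWithinAt_face (Γ.cube q₀.1) q₀.2.1 q₀.2.2 hp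
    exact hL.differentiableWithinAt
  have hint (q : ι × Fin (n + 1) × Bool) (hq : EqOn (F q) τ (stdCube n)) :
      faceIntegral (Γ.cube q.1) k g t q.2.1 q.2.2 = ∫ p in stdCube n,
        faceSign q.2.1 q.2.2 * (Γ.cube q.1).coeff (facePoint q.2.1 q.2.2 p) t *
          (g (τ p) * minorJacobian k τ p) := by
    refine setIntegral_congr_fun (measurableSet_stdCube n) fun p hp => ?_
    change _ * (g (F q p) * minorJacobian k (F q) p) = _
    rw [hq hp, minorJacobian_congr k hq hp]
  by_cases hdeg : IsDegenerate τ
  · refine (tsum_congr fun q => ?_).trans tsum_zero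
    rw [hint q.1 q.2]
    refine setIntegral_eq_zero_of_forall_eq_zero fun p hp => ?_
    rw [minorJacobian_of_isDegenerate k hdeg hp (hdiff hp), mul_zero, mul_zero]
  have hτc : ContinuousOn τ (stdCube n) := fun p hp => (hdiff hp).continuousWithinAt
  have hτmem {p : Fin n → ℝ} (hp : p ∈ stdCube n) : τ p ∈ configSpace J P (n + 1) t :=
    (Γ.cube q₀.1).mem t ht _ (facePoint_mem_stdCube _ _ hp)
  have h0 : (0 : Fin n → ℝ) ∈ stdCube n := ⟨le_rfl, zero_le_one⟩
  -- Every cube with face `τ` meets the compact image of `τ`, so local finiteness applies.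
  -- Finiteness also ensures that the `finsum` in the closedness condition is a genuine sum and not
  -- the default value `0` for infinite support.
  have hfin : {q | EqOn (F q) τ (stdCube n)}.Finite := by
    have := Γ.locallyFinite t ht (τ '' stdCube n) (image_subset_iff.2 fun p hp => hτmem hp)
      ((isCompact_stdCube n).image_of_continuousOn hτc)
    refine (this.prod (finite_univ (α := Fin (n + 1) × Bool))).subset fun q hq => ⟨?_, trivial⟩
    exact ⟨_, facePoint_mem_stdCube q.2.1 q.2.2 h0, 0, h0, (hq h0).symm⟩
  have hclosed {p : Fin n → ℝ} (hp : p ∈ stdCube n) : ∑ q ∈ hfin.toFinset,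
      faceSign q.2.1 q.2.2 * (Γ.cube q.1).coeff (facePoint q.2.1 q.2.2 p) t = 0 := by
    rw [← finsum_mem_eq_finite_toFinset_sum _ hfin]
    exact Γ.closed τ hdeg t ht p hp
  rw [tsum_subtype {q | EqOn (F q) τ (stdCube n)} fun q =>
      faceIntegral (Γ.cube q.1) k g t q.2.1 q.2.2,
    tsum_eq_sum (s := hfin.toFinset) fun q hq => indicator_of_notMem (by simpa using hq) _,
    Finset.sum_congr rfl fun q hq => by
      rw [indicator_of_mem (by simpa using hq), hint q (by simpa using hq)],
    ← integral_finsetSum]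
  · refine setIntegral_eq_zero_of_forall_eq_zero fun p hp => ?_
    rw [← Finset.sum_mul, hclosed hp, zero_mul]
  · intro q _
    refine ContinuousOn.integrableOn_compact (isCompact_stdCube n) ?_
    refine (continuousOn_const.mul (((Γ.cube q.1).continuousOn_coeff ht).comp
      (continuous_facePoint _ _).continuousOn fun p hp => facePoint_mem_stdCube _ _ hp)).mul
      ((hg.comp hτc fun p hp => hτmem hp).mul ?_)
    exact continuousOn_minorJacobian_face (Γ.cube q₀.1) k q₀.2.1 q₀.2.2

end Cycle

/-- The theorem of Stokes: total derivatives integrate to zero over a twisted cycle. -/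
theorem cycleIntegral_total_derivative {m : ℕ} (Γ : TwistedCycle J P m T ι) {t : ℂ} (ht : t ∈ T)
    (k : Fin m) {g : (Fin m → ℂ) → ℂ} {g' : (Fin m → ℂ) → (Fin m → ℂ) →L[ℂ] ℂ}
    (hg : ∀ u ∈ configSpace J P m t, HasFDerivAt g (g' u) u)
    (hmodg : ModerateOn J P {t} fun _ => g)
    (hmod : ModerateOn J P {t} fun _ u => g' u (Pi.single k 1)) :
    cycleIntegral Γ (fun t u =>
      logDerivative J (singExp J P) t u 0 (Pi.single k 1) * g u + g' u (Pi.single k 1)) t = 0 := by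
  rcases m with _ | n
  · exact k.elim0
  have hs := summable_faceIntegral Γ ht k hmodg
  rw [cycleIntegral, tsum_congr fun s =>
    integral_cubeIntegrand_eq_sum_faceIntegral (Γ.cube s) ht k hg hmodg hmod, tsum_mul_left]
  have h1 : ∑' s, ∑ q : Fin (n + 1) × Bool, faceIntegral (Γ.cube s) k g t q.1 q.2 =
      ∑' q : ι × Fin (n + 1) × Bool, faceIntegral (Γ.cube q.1) k g t q.2.1 q.2.2 := by
    rw [hs.tsum_prod]
    exact tsum_congr fun s => (tsum_fintype _).symm
  -- Absolute convergence permits regrouping the faces by their restriction to the standard cube;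
  -- each group sums to zero.
  have h2 := hs.hasSum.tsum_fiberwise fun q : ι × Fin (n + 1) × Bool =>
    (stdCube n).domRestrict fun r => (Γ.cube q.1).map (facePoint q.2.1 q.2.2 r)
  simp only [tsum_faceIntegral_eq_zero Γ ht k (hmodg.continuousOn t rfl)] at h2
  rw [h1, h2.unique hasSum_zero, mul_zero]

/-! ### The Schrödinger operator applied to the integrand -/

/-- The coefficient of `p²` in the Hamiltonian. -/
def hamCoeffTwo (J : PType) (t x : ℂ) : ℂ :=
  match J with
  | .VI => x * (x - 1) * (x - t) / (t * (t - 1))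
  | .V => x * (x - 1) / t
  | .IV => -x
  | .III => x ^ 2 / t
  | .II => 1 / 2

/-- The coefficient of `p` in the Hamiltonian. -/
def hamCoeffOne (J : PType) (P : Params) (t x : ℂ) : ℂ :=
  match J with
  | .VI => -((P.a + P.b) * (x - 1) * (x - t) + P.c * x * (x - t) + P.d * x * (x - 1)) /
      (t * (t - 1))
  | .V => (t * x ^ 2 - (P.b + P.c + t) * x + P.b) / t
  | .IV => -(x ^ 2 - t * x - P.b)
  | .III => -(x ^ 2 + P.b * x + t) / t
  | .II => -(x ^ 2 + t / 2)

/-- The term of order zero of the Hamiltonian. -/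
def hamCoeffZero (J : PType) (P : Params) (t x : ℂ) : ℂ :=
  match J with
  | .VI => (P.b + P.c + P.d + P.hbar) * P.a * (x - t) / (t * (t - 1))
  | .V => P.a * (P.b + P.c - P.a + P.hbar + t - t * x) / t
  | .IV => P.a * (x - t)
  | .III => P.a * x / t
  | .II => P.a * x

lemma hamiltonian_eq (t : ℂ) (f : ℂ → ℂ) (x : ℂ) :
    hamiltonian J P t f x = hamCoeffTwo J t x * momentum P.hbar (momentum P.hbar f) x +
      hamCoeffOne J P t x * momentum P.hbar f x + hamCoeffZero J P t x * f x := by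
  cases J <;> simp only [hamiltonian, hamCoeffTwo, hamCoeffOne, hamCoeffZero] <;> ring

/-- The function `α` in the forms `α(u_k) ∏_{j ≠ k} (x - u_j)` whose total derivatives make up the
difference of the two sides of the Schrödinger equation. -/
def formCoeff (J : PType) (t x u : ℂ) : ℂ :=
  match J with
  | .VI => (x - t) * (u * (u - 1)) / (t * (t - 1))
  | .V => u * (u - 1) / t
  | .IV => -u
  | .III => x * u / t
  | .II => 1 / 2

/-- The derivative of `formCoeff` with respect to `u`. -/
def formCoeffDeriv (J : PType) (t x u : ℂ) : ℂ :=
  match J with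
  | .VI => (x - t) * (2 * u - 1) / (t * (t - 1))
  | .V => (2 * u - 1) / t
  | .IV => -1
  | .III => x / t
  | .II => 0

/-- The coefficient of `u ^ 2` in `formCoeff`. -/
def formCoeffTwo (J : PType) (t x : ℂ) : ℂ :=
  match J with
  | .VI => (x - t) / (t * (t - 1))
  | .V => 1 / t
  | _ => 0

/-- The contribution of one variable to the term of order zero of the Hamiltonian. -/
def zeroContribution (J : PType) (P : Params) (t x : ℂ) : ℂ :=
  match J with
  | .VI => (x - t) * (P.a + P.b + P.c + P.d) / (t * (t - 1))
  | .V => (P.b + P.c + t - t * x) / t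
  | .IV => x - t
  | .III => x / t
  | .II => x

lemma hasDerivAt_formCoeff (t x u : ℂ) :
    HasDerivAt (formCoeff J t x) (formCoeffDeriv J t x u) u := by
  have hid := hasDerivAt_id u
  cases J <;> unfold formCoeff <;> simp only [formCoeffDeriv]
  · exact hasDerivAt_const _ _
  · exact ((hid.const_mul x).div_const t).congr_deriv (by simp)
  · exact hid.neg
  · exact ((hid.mul (hid.sub_const 1)).div_const t).congr_deriv (by simp; ring)
  · exact (((hid.mul (hid.sub_const 1)).const_mul (x - t)).div_const (t * (t - 1))).congr_deriv
      (by simp; ring)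

/-- For type VI the difference of the two sides is a multiple of `(a - mħ)(b + c + d - (m - 1)ħ)`,
which explains the two alternatives. -/
lemma hamCoeffZero_eq (h : ParamCondition J P m) (t x : ℂ) :
    hamCoeffZero J P t x = P.hbar * m * zeroContribution J P t x -
      P.hbar ^ 2 * (m * (m - 1)) * formCoeffTwo J t x := by
  cases J <;> simp only [ParamCondition] at h <;>
    simp only [hamCoeffZero, zeroContribution, formCoeffTwo]
  · rw [h]; ring
  · rw [h]; ring
  · rw [h]; ring
  · rw [h]; ring
  · rcases h with h | h
    · rw [h]; ring
    · linear_combination ((P.a - P.hbar * m) * (x - t) / (t * (t - 1))) * h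

/-- The one-variable part. Divided by `x - u`, it turns the `u`-derivative of the form with `ρ_J`
into the first order term, minus the time derivative of `log ρ_J`, plus a constant in `u`. -/
lemma formCoeff_identity {t x u : ℂ} (ht : t ∈ timeDomain J) (h0 : u ≠ 0) (h1 : 1 - u ≠ 0)
    (h2 : t - u ≠ 0) :
    formCoeffDeriv J t x u + (masterExponents J P 0 / u - masterExponents J P 1 / (1 - u) -
      masterExponents J P 2 / (t - u) + masterExpU J t u) * formCoeff J t x u =
    hamCoeffOne J P t x + (x - u) * (zeroContribution J P t x -
      (masterExponents J P 2 / (t - u) + masterExpT J u)) := by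
  cases J <;> simp [formCoeff, formCoeffDeriv, masterExponents, masterExpU, masterExpT,
    hamCoeffOne, zeroContribution, timeDomain] at ht ⊢
  · ring
  · field_simp
    ring
  · field_simp
    ring
  · field_simp
    ring
  · have ht0 := ht.1
    have ht1 := sub_ne_zero.2 ht.2
    field_simp
    ring

/-- As `α` has degree at most two, `α(u) / (x - u)` is `α(x) / (x - u)` minus a polynomial in `u` of
degree at most one with slope `formCoeffTwo`; and `α(x)` is `hamCoeffTwo`. -/
lemma formCoeff_pair_identity {t x u v : ℂ} (ht : t ∈ timeDomain J) (hu : x - u ≠ 0)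
    (hv : x - v ≠ 0) (huv : u - v ≠ 0) :
    (formCoeff J t x u / (x - u) - formCoeff J t x v / (x - v)) / (u - v) =
      hamCoeffTwo J t x * (1 / ((x - u) * (x - v))) - formCoeffTwo J t x := by
  cases J <;> simp [formCoeff, hamCoeffTwo, formCoeffTwo, timeDomain] at ht ⊢
  · field_simp
    ring
  · field_simp
    ring
  · field_simp
    ring
  · field_simp
    ring
  · have ht0 := ht.1
    have ht1 := sub_ne_zero.2 ht.2
    field_simp
    ring

/-- The factor `2` comes from the exponent `2ħ`; ordered pairs are what the second derivative of `∏
(x - u_i)` produces. -/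
lemma two_mul_sum_pairs (F : Fin m → Fin m → ℂ) (hF : ∀ i j, F i j = F j i) :
    2 * ∑ q : {q : Fin m × Fin m // q.1 < q.2}, F q.1.1 q.1.2 =
      ∑ i, ∑ j ∈ Finset.univ.erase i, F i j := by
  have h1 : ∑ q : {q : Fin m × Fin m // q.1 < q.2}, F q.1.1 q.1.2 =
      ∑ i, ∑ j, if i < j then F i j else 0 := by
    rw [← Fintype.sum_prod_type', ← Finset.sum_filter]
    exact (Finset.sum_subtype _ (by simp) fun q : Fin m × Fin m => F q.1 q.2).symm
  have h2 : ∑ i, ∑ j, (if i < j then F i j else 0) = ∑ i, ∑ j, if j < i then F i j else 0 := by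
    rw [Finset.sum_comm]
    simp_rw [hF]
  rw [two_mul, h1]
  nth_rewrite 2 [h2]
  rw [← Finset.sum_add_distrib]
  refine Finset.sum_congr rfl fun i _ => ?_
  rw [← Finset.sum_add_distrib, ← Finset.add_sum_erase _ _ (Finset.mem_univ i)]
  simp only [lt_self_iff_false, if_false, add_zero, zero_add]
  refine Finset.sum_congr rfl fun j hj => ?_
  rcases lt_trichotomy i j with h | h | h
  · simp [h, h.not_gt]
  · exact absurd h.symm (Finset.ne_of_mem_erase hj)
  · simp [h, h.not_gt]

/-- Where no factor vanishes, the polynomial part has a logarithmic derivative too, and the two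
kinds of exponents recombine into those of the whole integrand. -/
lemma logDerivative_mul_polyPart_add {t : ℂ} {u : Fin m → ℂ}
    (hu : ∀ f : Factor m, factorValue t u f ≠ 0)
    (τ : ℂ) (v : Fin m → ℂ) :
    logDerivative J (singExp J P) t u τ v * polyPart J P t u + polyDeriv J P t u τ v =
      polyPart J P t u * logDerivative J (factorExponent J P) t u τ v := by
  have h : polyDeriv J P t u τ v = polyPart J P t u *
      ∑ f, natExp J P f * (factorSlope τ v f * (factorValue t u f)⁻¹) := by
    rw [polyDeriv, Finset.mul_sum]
    refine Finset.sum_congr rfl fun f _ => ?_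
    rw [polyPart_eq_prod, ← Finset.mul_prod_erase _ _ (Finset.mem_univ f)]
    rcases Nat.eq_zero_or_pos (natExp J P f) with hn | hn
    · simp [hn]
    · obtain ⟨n, hn⟩ := Nat.exists_eq_add_of_lt hn
      rw [hn]
      simp only [zero_add, Nat.add_sub_cancel]
      have hf := hu f
      field_simp
      ring
  rw [h, logDerivative, logDerivative]
  simp only [← singExp_add_natExp, add_mul, Finset.sum_add_distrib]
  ring

lemma logDerivative_factorExponent (t : ℂ) (u : Fin m → ℂ) (τ : ℂ) (v : Fin m → ℂ) :
    logDerivative J (factorExponent J P) t u τ v =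
      2 * P.hbar * ∑ q : {q : Fin m × Fin m // q.1 < q.2},
        (v q.1.1 - v q.1.2) / (u q.1.1 - u q.1.2) +
      ∑ i, ((masterExponents J P 2 / (t - u i) + masterExpT J (u i)) * τ +
        (masterExponents J P 0 / u i - masterExponents J P 1 / (1 - u i) -
          masterExponents J P 2 / (t - u i) + masterExpU J t (u i)) * v i) := by
  rw [logDerivative, Fintype.sum_sum_type, Fintype.sum_prod_type, add_assoc,
    ← Finset.sum_add_distrib, Finset.mul_sum]
  congr 1
  refine Finset.sum_congr rfl fun i _ => ?_
  simp [Fin.sum_univ_three, factorExponent, factorSlope, factorValue]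
  ring

/-- The identity behind the Schrödinger equation, divided by the integrand. -/
lemma schrodinger_identity_div (h : ParamCondition J P m) {t x : ℂ} (ht : t ∈ timeDomain J)
    {u : Fin m → ℂ} (hu : ∀ f : Factor m, factorValue t u f ≠ 0) (hx : ∀ i, x - u i ≠ 0) :
    hamCoeffTwo J t x * (P.hbar ^ 2 *
        ∑ i, ∑ j ∈ Finset.univ.erase i, 1 / ((x - u i) * (x - u j))) +
      hamCoeffOne J P t x * (P.hbar * ∑ i, 1 / (x - u i)) + hamCoeffZero J P t x -
      P.hbar * logDerivative J (factorExponent J P) t u 1 0 =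
    P.hbar * (logDerivative J (factorExponent J P) t u 0
        (fun i => formCoeff J t x (u i) / (x - u i)) +
      ∑ i, formCoeffDeriv J t x (u i) / (x - u i)) := by
  have h1 : 2 * ∑ q : {q : Fin m × Fin m // q.1 < q.2},
      (formCoeff J t x (u q.1.1) / (x - u q.1.1) - formCoeff J t x (u q.1.2) / (x - u q.1.2)) /
        (u q.1.1 - u q.1.2) =
      hamCoeffTwo J t x * (∑ i, ∑ j ∈ Finset.univ.erase i, 1 / ((x - u i) * (x - u j))) -
        m * (m - 1) * formCoeffTwo J t x := by
    rw [Finset.sum_congr rfl fun q _ => formCoeff_pair_identity ht (hx q.1.1) (hx q.1.2)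
        (hu (.inl q)),
      two_mul_sum_pairs (fun i j => hamCoeffTwo J t x * (1 / ((x - u i) * (x - u j))) -
        formCoeffTwo J t x) fun i j => by ring]
    simp only [Finset.sum_sub_distrib, ← Finset.mul_sum, Finset.sum_const,
      Finset.card_erase_of_mem (Finset.mem_univ _), Finset.card_univ, Fintype.card_fin,
      nsmul_eq_mul]
    -- The number of indices `j ≠ i` is a truncated difference `m - 1`, so `m = 0` is separate.
    rcases m with _ | m
    · simp
    · push_cast
      simp
      ring
  have h2 (i : Fin m) : (masterExponents J P 0 / u i - masterExponents J P 1 / (1 - u i) -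
        masterExponents J P 2 / (t - u i) + masterExpU J t (u i)) *
          (formCoeff J t x (u i) / (x - u i)) + formCoeffDeriv J t x (u i) / (x - u i) =
      hamCoeffOne J P t x * (1 / (x - u i)) + zeroContribution J P t x -
        (masterExponents J P 2 / (t - u i) + masterExpT J (u i)) := by
    have := formCoeff_identity (P := P) (x := x) (u := u i) ht (hu (.inr (i, 0))) (hu (.inr (i, 1)))
      (hu (.inr (i, 2)))
    have hxi := hx i
    rw [← mul_div_assoc, ← add_div, add_comm, this]
    field_simp
    ring
  rw [logDerivative_factorExponent, logDerivative_factorExponent, hamCoeffZero_eq h]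
  simp only [mul_one, mul_zero, add_zero, zero_add, Pi.zero_apply, sub_zero, zero_div,
    Finset.sum_const_zero]
  have h3 := Finset.sum_congr rfl fun i (_ : i ∈ Finset.univ) => h2 i
  simp only [Finset.sum_add_distrib, Finset.sum_sub_distrib, ← Finset.mul_sum, Finset.sum_const,
    Finset.card_univ, Fintype.card_fin, nsmul_eq_mul] at h3 ⊢
  linear_combination (-P.hbar ^ 2) * h1 - P.hbar * h3

/-! ### The polynomial `∏ (x - u_i)` -/

open Polynomial

/-- The polynomial `∏ (x - u_i)` in `x`. -/
def rootPoly (u : Fin m → ℂ) : ℂ[X] := ∏ i, (X - C (u i))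

lemma natDegree_rootPoly (u : Fin m → ℂ) : (rootPoly u).natDegree = m := by
  simp [rootPoly, natDegree_prod_of_monic _ _ fun i _ => monic_X_sub_C (u i)]

lemma eval_rootPoly (x : ℂ) (u : Fin m → ℂ) : (rootPoly u).eval x = ∏ i, (x - u i) := by
  simp [rootPoly, eval_prod]

lemma eval_derivative_rootPoly {x : ℂ} {u : Fin m → ℂ} (hx : ∀ i, x - u i ≠ 0) :
    (derivative (rootPoly u)).eval x = (∏ i, (x - u i)) * ∑ i, 1 / (x - u i) := by
  rw [rootPoly, derivative_prod_finset, eval_finsetSum, Finset.mul_sum]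
  refine Finset.sum_congr rfl fun i _ => ?_
  rw [← Finset.mul_prod_erase _ _ (Finset.mem_univ i)]
  have := hx i
  simp [eval_prod]
  field_simp

lemma eval_derivative_derivative_rootPoly {x : ℂ} {u : Fin m → ℂ} (hx : ∀ i, x - u i ≠ 0) :
    (derivative (derivative (rootPoly u))).eval x =
      (∏ i, (x - u i)) * ∑ i, ∑ j ∈ Finset.univ.erase i, 1 / ((x - u i) * (x - u j)) := by
  rw [rootPoly, derivative_prod_finset, derivative_sum, eval_finsetSum, Finset.mul_sum]
  refine Finset.sum_congr rfl fun i _ => ?_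
  rw [derivative_X_sub_C, mul_one, derivative_prod_finset, eval_finsetSum, Finset.mul_sum]
  refine Finset.sum_congr rfl fun j hj => ?_
  rw [← Finset.mul_prod_erase _ _ (Finset.mem_univ i), ← Finset.mul_prod_erase _ _ hj]
  have := hx i
  have := hx j
  simp [eval_prod]
  field_simp

namespace ModerateOn

variable {K : Set ℂ}

/-- The coefficients are polynomials in `u`, built by adding one root at a time. They are integrated
separately to give the coefficients of the solution. -/
lemma coeff_rootPoly (k : ℕ) : ModerateOn J P K fun _ (u : Fin m → ℂ) => (rootPoly u).coeff k := by
  suffices h : ∀ s : Finset (Fin m), ∀ k, ModerateOn J P K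
      fun _ (u : Fin m → ℂ) => (∏ i ∈ s, (X - C (u i))).coeff k from h Finset.univ k
  intro s
  induction s using Finset.induction_on with
  | empty => exact fun k => const _
  | insert a s ha ih =>
    intro k
    simp_rw [Finset.prod_insert ha, sub_mul, coeff_sub, coeff_C_mul]
    rcases k with _ | k
    · simp only [mul_coeff_zero, coeff_X_zero, zero_mul, zero_sub]
      exact ((coord a).mul (ih 0)).neg
    · simp only [coeff_X_mul]
      exact (ih k).sub ((coord a).mul (ih (k + 1)))

lemma eval_of_coeff {q : (Fin m → ℂ) → ℂ[X]} (hq : ∀ u, (q u).natDegree ≤ m)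
    (hc : ∀ k, ModerateOn J P K fun _ u => (q u).coeff k) (x : ℂ) :
    ModerateOn J P K fun _ u => (q u).eval x := by
  simp_rw [fun u => eval_eq_sum_range' (Nat.lt_succ_of_le (hq u)) x]
  exact sum _ fun k _ => (hc k).mul (const _)

lemma coeff_derivative {q : (Fin m → ℂ) → ℂ[X]}
    (hc : ∀ k, ModerateOn J P K fun _ u => (q u).coeff k) (k : ℕ) :
    ModerateOn J P K fun _ u => (derivative (q u)).coeff k := by
  simp_rw [Polynomial.coeff_derivative]
  exact (hc (k + 1)).mul (const _)

lemma eval_rootPoly (x : ℂ) : ModerateOn J P K fun _ (u : Fin m → ℂ) => (rootPoly u).eval x :=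
  eval_of_coeff (fun u => (natDegree_rootPoly u).le) coeff_rootPoly x

lemma eval_derivative_rootPoly (x : ℂ) :
    ModerateOn J P K fun _ (u : Fin m → ℂ) => (derivative (rootPoly u)).eval x :=
  eval_of_coeff (fun u => (natDegree_derivative_le _).trans
    ((Nat.sub_le _ _).trans (natDegree_rootPoly u).le)) (coeff_derivative coeff_rootPoly) x

lemma eval_derivative_derivative_rootPoly (x : ℂ) :
    ModerateOn J P K fun _ (u : Fin m → ℂ) => (derivative (derivative (rootPoly u))).eval x :=
  eval_of_coeff (fun u => (natDegree_derivative_le _).trans ((Nat.sub_le _ _).trans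
    ((natDegree_derivative_le _).trans ((Nat.sub_le _ _).trans (natDegree_rootPoly u).le))))
    (coeff_derivative (coeff_derivative coeff_rootPoly)) x

end ModerateOn

/-- A continuous function on the configuration space vanishes if it vanishes where all the factors
and all `x - u_i` are different from zero. -/
lemma eq_zero_of_generic {t x : ℂ} {F : (Fin m → ℂ) → ℂ}
    (hF : ContinuousOn F (configSpace J P m t))
    (h : ∀ u, (∀ f : Factor m, factorValue t u f ≠ 0) → (∀ i, x - u i ≠ 0) → F u = 0)
    {u : Fin m → ℂ} (hu : u ∈ configSpace J P m t) : F u = 0 := by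
  -- A direction with distinct nonzero coordinates: along it every factor and every `x - u_i` has
  -- nonzero slope, so none vanishes for small nonzero `ε`.
  set v : Fin m → ℂ := fun i => (i : ℂ) + 1 with hv
  have hline {a b : ℂ} (hb : b ≠ 0) : ∀ᶠ ε : ℂ in 𝓝[≠] 0, a + ε * b ≠ 0 := by
    have hd : HasDerivAt (fun ε : ℂ => a + ε * b) b 0 := by
      simpa using ((hasDerivAt_id (0 : ℂ)).mul_const b).const_add a
    exact hd.eventually_ne hb
  have hvi (i : Fin m) : v i ≠ 0 := by
    simp only [hv]; exact_mod_cast Nat.succ_ne_zero i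
  have hslope (f : Factor m) : factorSlope 0 v f ≠ 0 := by
    rcases f with ⟨q, hq⟩ | ⟨i, k⟩
    · simp only [factorSlope, hv, add_sub_add_right_eq_sub, sub_ne_zero]
      exact_mod_cast fun h => hq.ne (Fin.ext h)
    · fin_cases k <;> simpa [factorSlope] using hvi i
  have hev : ∀ᶠ ε : ℂ in 𝓝[≠] 0, F (u + ε • v) = 0 := by
    have h1 : ∀ᶠ ε : ℂ in 𝓝[≠] 0, ∀ f : Factor m, factorValue t (u + ε • v) f ≠ 0 := by
      rw [eventually_all]
      refine fun f => (hline (a := factorValue t u f) (hslope f)).mono fun ε hε => ?_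
      have h2 := factorValue_add t 0 u (ε • v) f
      have h3 := factorSlope_smul ε 0 v f
      rw [mul_zero] at h3
      rw [add_zero, h3] at h2
      rwa [h2]
    have h2 : ∀ᶠ ε : ℂ in 𝓝[≠] 0, ∀ i, x - (u + ε • v) i ≠ 0 := by
      rw [eventually_all]
      refine fun i => (hline (a := x - u i) (neg_ne_zero.2 (hvi i))).mono fun ε hε => ?_
      simpa [sub_eq_add_neg, add_comm, add_left_comm, add_assoc] using hε
    filter_upwards [h1, h2] with ε hε hε' using h _ hε hε'
  have hcont : Tendsto (fun ε : ℂ => F (u + ε • v)) (𝓝[≠] 0) (𝓝 (F u)) := by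
    have h1 : ContinuousAt F (u + (0 : ℂ) • v) := by
      simpa using hF.continuousAt ((isOpen_configSpace t).mem_nhds hu)
    have h2 : ContinuousAt (fun ε : ℂ => F (u + ε • v)) 0 :=
      ContinuousAt.comp (f := fun ε : ℂ => u + ε • v) h1 (by fun_prop)
    simpa using h2.tendsto.mono_left nhdsWithin_le_nhds
  exact tendsto_nhds_unique (hcont.congr' hev) tendsto_const_nhds

/-! ### The Schrödinger equation -/

/-- The value of the Hamiltonian on a polynomial. -/
def hamiltonianPoly (J : PType) (P : Params) (t x : ℂ) (q : ℂ[X]) : ℂ :=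
  hamCoeffTwo J t x * (P.hbar ^ 2 * (derivative (derivative q)).eval x) +
    hamCoeffOne J P t x * (P.hbar * (derivative q).eval x) + hamCoeffZero J P t x * q.eval x

lemma hamiltonian_eval (t x : ℂ) (q : ℂ[X]) :
    hamiltonian J P t (fun x => q.eval x) x = hamiltonianPoly J P t x q := by
  have h (c : ℂ) (r : ℂ[X]) : momentum P.hbar (fun x => c * r.eval x) =
      fun x => P.hbar * c * (derivative r).eval x := by
    funext y
    simp [momentum, mul_assoc]
  have h1 := h 1 q
  simp only [one_mul, mul_one] at h1
  rw [hamiltonian_eq, h1, h, hamiltonianPoly]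
  ring

lemma hamiltonianPoly_sum {α : Type*} (s : Finset α) (c : α → ℂ) (q : α → ℂ[X]) (t x : ℂ) :
    hamiltonianPoly J P t x (∑ a ∈ s, C (c a) * q a) =
      ∑ a ∈ s, c a * hamiltonianPoly J P t x (q a) := by
  simp only [hamiltonianPoly, derivative_sum, derivative_C_mul, eval_finsetSum, eval_mul, eval_C,
    Finset.mul_sum, ← Finset.sum_add_distrib]
  exact Finset.sum_congr rfl fun a _ => by ring

lemma rootPoly_eq_sum (u : Fin m → ℂ) :
    rootPoly u = ∑ i : Fin (m + 1), C ((rootPoly u).coeff i) * X ^ (i : ℕ) := by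
  rw [Fin.sum_univ_eq_sum_range (fun i => C ((rootPoly u).coeff i) * X ^ i) (m + 1)]
  exact (as_sum_range_C_mul_X_pow' _ (by simp [natDegree_rootPoly]))

/-- The function `α(u_k) ∏_{j ≠ k} (x - u_j)`. -/
def formFunction (J : PType) (t x : ℂ) (k : Fin m) (u : Fin m → ℂ) : ℂ :=
  formCoeff J t x (u k) * ∏ j ∈ Finset.univ.erase k, (x - u j)

/-- The derivative of `formFunction` with respect to `u_k`. -/
def formFunctionDeriv (J : PType) (t x : ℂ) (k : Fin m) (u : Fin m → ℂ) : ℂ :=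
  formCoeffDeriv J t x (u k) * ∏ j ∈ Finset.univ.erase k, (x - u j)

lemma hasFDerivAt_formFunction (t x : ℂ) (k : Fin m) (u : Fin m → ℂ) :
    ∃ L : (Fin m → ℂ) →L[ℂ] ℂ, HasFDerivAt (formFunction J t x k) L u ∧
      L (Pi.single k 1) = formFunctionDeriv J t x k u := by
  have h1 := (hasDerivAt_formCoeff (J := J) t x (u k)).hasFDerivAt.comp u
    (hasFDerivAt_apply (𝕜 := ℂ) k u)
  have h2 := HasFDerivAt.finsetProd (u := Finset.univ.erase k) (x := u)
    (g := fun (j : Fin m) (u : Fin m → ℂ) => x - u j)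
    fun j _ => (hasFDerivAt_apply (𝕜 := ℂ) j u).const_sub x
  refine ⟨_, h1.mul h2, ?_⟩
  have h3 : (∑ i ∈ Finset.univ.erase k, (∏ j ∈ (Finset.univ.erase k).erase i, (x - u j)) •
      -ContinuousLinearMap.proj (R := ℂ) (φ := fun _ : Fin m => ℂ) i) (Pi.single k 1) = 0 := by
    rw [sum_apply]
    exact Finset.sum_eq_zero fun i hi => by simp [Finset.ne_of_mem_erase hi]
  rw [add_apply, smul_apply, smul_apply, h3]
  simp [formFunctionDeriv, mul_comm]

namespace ModerateOn

variable {K : Set ℂ}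

/-- The time is frozen here, so the denominators of `α` are constants. This suffices because total
derivatives are integrated at one time only. -/
lemma formCoeff (t x : ℂ) (k : Fin m) :
    ModerateOn J P K fun _ (u : Fin m → ℂ) => formCoeff J t x (u k) := by
  cases J <;> simp only [QuantumPainleve.formCoeff, div_eq_mul_inv]
  · exact const _
  · exact ((const _).mul (coord k)).mul (const _)
  · exact (coord k).neg
  · exact ((coord k).mul ((coord k).sub (const 1))).mul (const _)
  · exact ((const _).mul ((coord k).mul ((coord k).sub (const 1)))).mul (const _)

lemma formCoeffDeriv (t x : ℂ) (k : Fin m) :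
    ModerateOn J P K fun _ (u : Fin m → ℂ) => formCoeffDeriv J t x (u k) := by
  cases J <;> simp only [QuantumPainleve.formCoeffDeriv, div_eq_mul_inv]
  · exact const _
  · exact const _
  · exact const _
  · exact (((const 2).mul (coord k)).sub (const 1)).mul (const _)
  · exact ((const _).mul (((const 2).mul (coord k)).sub (const 1))).mul (const _)

lemma formFunction (t x : ℂ) (k : Fin m) : ModerateOn J P K fun _ => formFunction J t x k :=
  (formCoeff t x k).mul (prod _ fun j _ => (const x).sub (coord j))

lemma formFunctionDeriv (t x : ℂ) (k : Fin m) :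
    ModerateOn J P K fun _ => formFunctionDeriv J t x k :=
  (formCoeffDeriv t x k).mul (prod _ fun j _ => (const x).sub (coord j))

lemma hamiltonianPoly_rootPoly (t x : ℂ) :
    ModerateOn J P K fun _ (u : Fin m → ℂ) => hamiltonianPoly J P t x (rootPoly u) :=
  (((const _).mul ((const _).mul (eval_derivative_derivative_rootPoly x))).add
    ((const _).mul ((const _).mul (eval_derivative_rootPoly x)))).add
    ((const _).mul (eval_rootPoly x))

end ModerateOn

/-- The total derivative with respect to `u_k`, divided by the many-valued part of the
integrand. -/
def totalDerivative (J : PType) (P : Params) (t x : ℂ) (k : Fin m) (u : Fin m → ℂ) : ℂ :=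
  logDerivative J (singExp J P) t u 0 (Pi.single k 1) *
      (polyPart J P t u * formFunction J t x k u) +
    (polyDeriv J P t u 0 (Pi.single k 1) * formFunction J t x k u +
      polyPart J P t u * formFunctionDeriv J t x k u)

lemma moderateOn_totalDerivative (t x : ℂ) (k : Fin m) :
    ModerateOn J P {t} fun t' => totalDerivative J P t' x k := by
  have ht : Bornology.IsBounded ({t} : Set ℂ) := Bornology.isBounded_singleton
  have h := ((ModerateOn.logDerivative (J := J) (P := P) ht 0 (Pi.single k 1)).mul
    ((ModerateOn.polyPart ht).mul (ModerateOn.formFunction t x k))).add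
    (((ModerateOn.polyDeriv ht 0 (Pi.single k 1)).mul (ModerateOn.formFunction t x k)).add
      ((ModerateOn.polyPart ht).mul (ModerateOn.formFunctionDeriv t x k)))
  refine h.congr fun t' ht' u _ => ?_
  rw [mem_singleton_iff.1 ht']
  rfl

lemma cycleIntegral_totalDerivative (Γ : TwistedCycle J P m T ι) {t : ℂ} (ht : t ∈ T) (x : ℂ)
    (k : Fin m) : cycleIntegral Γ (fun t' => totalDerivative J P t' x k) t = 0 := by
  have hb : Bornology.IsBounded ({t} : Set ℂ) := Bornology.isBounded_singleton
  have hL (u : Fin m → ℂ) : ∃ L : (Fin m → ℂ) →L[ℂ] ℂ,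
      HasFDerivAt (fun u => polyPart J P t u * formFunction J t x k u) L u ∧
      L (Pi.single k 1) = polyDeriv J P t u 0 (Pi.single k 1) * formFunction J t x k u +
        polyPart J P t u * formFunctionDeriv J t x k u := by
    obtain ⟨L₁, h₁, h₁'⟩ := hasFDerivAt_polyPart (J := J) (P := P) t u
    obtain ⟨L₂, h₂, h₂'⟩ := hasFDerivAt_formFunction (J := J) t x k u
    refine ⟨_, h₁.mul h₂, ?_⟩
    simp [h₁', h₂']
    ring
  choose g' hg' hg'' using hL
  have h := cycleIntegral_total_derivative Γ ht k
    (g := fun u => polyPart J P t u * formFunction J t x k u) (g' := g') (fun u _ => hg' u)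
    ((((ModerateOn.polyPart hb).mul (ModerateOn.formFunction t x k))).congr fun t' ht' u _ => by
      rw [mem_singleton_iff.1 ht'])
    ((((ModerateOn.polyDeriv hb 0 (Pi.single k 1)).mul (ModerateOn.formFunction t x k)).add
      ((ModerateOn.polyPart hb).mul (ModerateOn.formFunctionDeriv t x k))).congr
      fun t' ht' u _ => by rw [mem_singleton_iff.1 ht', hg''])
  rw [← h]
  refine cycleIntegral_congr Γ ht fun u _ => ?_
  rw [hg'']
  rfl

/-- The two sides of the Schrödinger equation differ by total derivatives. -/
lemma schrodinger_identity (h : ParamCondition J P m) {t : ℂ} (ht : t ∈ timeDomain J) (x : ℂ)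
    {u : Fin m → ℂ} (hu : u ∈ configSpace J P m t) :
    polyPart J P t u * hamiltonianPoly J P t x (rootPoly u) =
      P.hbar * ((logDerivative J (singExp J P) t u 1 0 * polyPart J P t u +
        polyDeriv J P t u 1 0) * (rootPoly u).eval x) +
      P.hbar * ∑ k, totalDerivative J P t x k u := by
  have hb : Bornology.IsBounded ({t} : Set ℂ) := Bornology.isBounded_singleton
  have hmod : ModerateOn J P {t} fun t' (u : Fin m → ℂ) =>
      polyPart J P t' u * hamiltonianPoly J P t x (rootPoly u) -
      (P.hbar * ((logDerivative J (singExp J P) t' u 1 0 * polyPart J P t' u +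
        polyDeriv J P t' u 1 0) * (rootPoly u).eval x) +
      P.hbar * ∑ k, totalDerivative J P t' x k u) :=
    ((ModerateOn.polyPart hb).mul (ModerateOn.hamiltonianPoly_rootPoly t x)).sub
      (((ModerateOn.const _).mul ((((ModerateOn.logDerivative hb 1 0).mul
        (ModerateOn.polyPart hb)).add (ModerateOn.polyDeriv hb 1 0)).mul
        (ModerateOn.eval_rootPoly x))).add
        ((ModerateOn.const _).mul (ModerateOn.sum _ fun k _ => moderateOn_totalDerivative t x k)))
  -- Both sides are continuous on the configuration space, although the identity is proved by
  -- dividing by nonsingular factors and by `x - u_i`, which may vanish there.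
  refine sub_eq_zero.1 (eq_zero_of_generic (x := x) (hmod.continuousOn t rfl) ?_ hu)
  intro u hf hx
  have hk (k : Fin m) : totalDerivative J P t x k u =
      polyPart J P t u * (∏ i, (x - u i)) * (formCoeff J t x (u k) / (x - u k) *
        logDerivative J (factorExponent J P) t u 0 (Pi.single k 1) +
          formCoeffDeriv J t x (u k) / (x - u k)) := by
    have hlog := logDerivative_mul_polyPart_add (J := J) (P := P) hf 0 (Pi.single k 1)
    have hxk := hx k
    rw [← Finset.mul_prod_erase _ _ (Finset.mem_univ k)]
    simp only [totalDerivative, formFunction, formFunctionDeriv]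
    field_simp
    linear_combination (formCoeff J t x (u k) * ∏ j ∈ Finset.univ.erase k, (x - u j)) * hlog
  have hsum : ∑ k, totalDerivative J P t x k u = polyPart J P t u * (∏ i, (x - u i)) *
      (logDerivative J (factorExponent J P) t u 0 (fun i => formCoeff J t x (u i) / (x - u i)) +
        ∑ i, formCoeffDeriv J t x (u i) / (x - u i)) := by
    rw [logDerivative_eq_sum, ← Finset.sum_add_distrib, Finset.mul_sum]
    exact Finset.sum_congr rfl fun k _ => hk k
  rw [hsum, logDerivative_mul_polyPart_add hf, eval_rootPoly, hamiltonianPoly, eval_rootPoly,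
    eval_derivative_rootPoly hx, eval_derivative_derivative_rootPoly hx]
  linear_combination (polyPart J P t u * ∏ i, (x - u i)) * schrodinger_identity_div h ht hf hx

/-! ### The integral as a polynomial solution -/

section Solution

variable (Γ : TwistedCycle J P m T ι) {t : ℂ}

lemma pullbackIntegrand_eq (σ : TwistedCube J P m T m) (x t : ℂ) :
    pullbackIntegrand σ x t =
      cubeIntegrand σ (fun t u => polyPart J P t u * (rootPoly u).eval x) t := by
  funext p
  rw [pullbackIntegrand, cubeIntegrand, eval_rootPoly]
  ring

lemma moderateOn_polyPart_mul_eval {K : Set ℂ} (hK : Bornology.IsBounded K) (x : ℂ) :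
    ModerateOn J P K fun t (u : Fin m → ℂ) => polyPart J P t u * (rootPoly u).eval x :=
  (ModerateOn.polyPart hK).mul (ModerateOn.eval_rootPoly x)

/-- The coefficient of `x ^ i` in the integral. -/
def coeffIntegral (i : ℕ) : ℂ → ℂ :=
  cycleIntegral Γ fun t u => polyPart J P t u * (rootPoly u).coeff i

lemma hypergeometricIntegral_eq_cycleIntegral (x t : ℂ) :
    hypergeometricIntegral Γ x t =
      cycleIntegral Γ (fun t u => polyPart J P t u * (rootPoly u).eval x) t := by
  simp only [hypergeometricIntegral, cycleIntegral, pullbackIntegrand_eq]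

lemma sum_coeffIntegral_mul (ht : t ∈ T) (c : Fin (m + 1) → ℂ) :
    ∑ i : Fin (m + 1), c i * coeffIntegral Γ i t =
      cycleIntegral Γ (fun t u => polyPart J P t u *
        ∑ i : Fin (m + 1), (rootPoly u).coeff i * c i) t := by
  simp only [coeffIntegral, ← cycleIntegral_const_mul]
  rw [← cycleIntegral_sum Γ ht]
  · refine cycleIntegral_congr Γ ht fun u _ => ?_
    rw [Finset.mul_sum]
    exact Finset.sum_congr rfl fun i _ => by ring
  · exact fun i _ => (ModerateOn.const _).mul
      ((ModerateOn.polyPart Bornology.isBounded_singleton).mul (ModerateOn.coeff_rootPoly i))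

lemma hypergeometricIntegral_eq_sum (ht : t ∈ T) (x : ℂ) :
    hypergeometricIntegral Γ x t = ∑ i : Fin (m + 1), coeffIntegral Γ i t * x ^ (i : ℕ) := by
  rw [hypergeometricIntegral_eq_cycleIntegral]
  simp_rw [mul_comm (coeffIntegral Γ _ t)]
  rw [sum_coeffIntegral_mul Γ ht]
  refine cycleIntegral_congr Γ ht fun u _ => ?_
  conv_lhs => rw [rootPoly_eq_sum u]
  simp [eval_finsetSum]

lemma hasDerivAt_coeffIntegral (hT : IsOpen T) (ht : t ∈ T) (i : ℕ) :
    HasDerivAt (coeffIntegral Γ i) (cycleIntegral Γ (fun t u =>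
      logDerivative J (singExp J P) t u 1 0 * (polyPart J P t u * (rootPoly u).coeff i) +
        polyDeriv J P t u 1 0 * (rootPoly u).coeff i) t) t :=
  hasDerivAt_cycleIntegral Γ hT ht
    (fun _ _ hK => (ModerateOn.polyPart hK.isBounded).mul (ModerateOn.coeff_rootPoly i))
    (fun _ _ hK => (ModerateOn.polyDeriv hK.isBounded 1 0).mul (ModerateOn.coeff_rootPoly i))
    fun t u => (hasDerivAt_polyPart t u).mul_const _

lemma hasDerivAt_hypergeometricIntegral (hT : IsOpen T) (ht : t ∈ T) (x : ℂ) :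
    HasDerivAt (hypergeometricIntegral Γ x) (cycleIntegral Γ (fun t u =>
      (logDerivative J (singExp J P) t u 1 0 * polyPart J P t u +
        polyDeriv J P t u 1 0) * (rootPoly u).eval x) t) t := by
  have h := hasDerivAt_cycleIntegral Γ hT ht
    (G := fun t u => polyPart J P t u * (rootPoly u).eval x)
    (H := fun t u => polyDeriv J P t u 1 0 * (rootPoly u).eval x)
    (fun _ _ hK => moderateOn_polyPart_mul_eval hK.isBounded x)
    (fun _ _ hK => (ModerateOn.polyDeriv hK.isBounded 1 0).mul (ModerateOn.eval_rootPoly x))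
    fun t u => (hasDerivAt_polyPart t u).mul_const _
  rw [show hypergeometricIntegral Γ x = _ from
    funext (hypergeometricIntegral_eq_cycleIntegral Γ x)]
  refine h.congr_deriv (cycleIntegral_congr Γ ht fun u _ => ?_)
  ring

/-- The operator acts on a polynomial in `x` whose coefficients are integrals; its linearity moves
it inside the integral. -/
lemma hamiltonian_hypergeometricIntegral (ht : t ∈ T) (x : ℂ) :
    hamiltonian J P t (fun x => hypergeometricIntegral Γ x t) x =
      cycleIntegral Γ
        (fun t' u => polyPart J P t' u * hamiltonianPoly J P t' x (rootPoly u)) t := by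
  have h : (fun x => hypergeometricIntegral Γ x t) = fun x =>
      (∑ i : Fin (m + 1), C (coeffIntegral Γ i t) * X ^ (i : ℕ) : ℂ[X]).eval x := by
    funext x
    simp [hypergeometricIntegral_eq_sum Γ ht, eval_finsetSum]
  rw [h, hamiltonian_eval, hamiltonianPoly_sum]
  simp_rw [mul_comm (coeffIntegral Γ _ t)]
  rw [sum_coeffIntegral_mul Γ ht]
  refine cycleIntegral_congr Γ ht fun u _ => ?_
  rw [← hamiltonianPoly_sum, ← rootPoly_eq_sum]

/-- `schrodinger_identity` is integrated over the cycle, and the total derivatives disappear by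
Stokes. -/
theorem hypergeometricIntegral_schrodinger (hP : ParamCondition J P m) (hTJ : T ⊆ timeDomain J)
    (hT : IsOpen T) (ht : t ∈ T) (x : ℂ) :
    P.hbar * deriv (hypergeometricIntegral Γ x) t =
      hamiltonian J P t (fun x => hypergeometricIntegral Γ x t) x := by
  have hb : Bornology.IsBounded ({t} : Set ℂ) := Bornology.isBounded_singleton
  have h1 : ModerateOn J P {t} fun t (u : Fin m → ℂ) =>
      (logDerivative J (singExp J P) t u 1 0 * polyPart J P t u +
        polyDeriv J P t u 1 0) * (rootPoly u).eval x :=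
    (((ModerateOn.logDerivative hb 1 0).mul (ModerateOn.polyPart hb)).add
      (ModerateOn.polyDeriv hb 1 0)).mul (ModerateOn.eval_rootPoly x)
  have h2 (k : Fin m) := moderateOn_totalDerivative (J := J) (P := P) t x k
  have h3 := cycleIntegral_congr Γ ht
    (G := fun t' u => polyPart J P t' u * hamiltonianPoly J P t' x (rootPoly u))
    (H := fun t' u => P.hbar * ((logDerivative J (singExp J P) t' u 1 0 * polyPart J P t' u +
      polyDeriv J P t' u 1 0) * (rootPoly u).eval x) +
      P.hbar * ∑ k, totalDerivative J P t' x k u)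
    fun u hu => schrodinger_identity hP (hTJ ht) x hu
  rw [(hasDerivAt_hypergeometricIntegral Γ hT ht x).deriv,
    hamiltonian_hypergeometricIntegral Γ ht, h3,
    cycleIntegral_add Γ ht ((ModerateOn.const _).mul h1)
      ((ModerateOn.const _).mul (.sum _ fun k _ => h2 k)),
    cycleIntegral_const_mul, cycleIntegral_const_mul,
    cycleIntegral_sum Γ ht Finset.univ fun k _ => h2 k,
    Finset.sum_eq_zero fun k _ => cycleIntegral_totalDerivative Γ ht x k, mul_zero, add_zero]

end Solution

end QuantumPainleve

end

theorem mainTheorem1 (J : QuantumPainleve.PType) (P : QuantumPainleve.Params) (m : ℕ)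
    (hP : QuantumPainleve.ParamCondition J P m)
    (T : Set ℂ) (hT : IsOpen T) (hTJ : T ⊆ QuantumPainleve.timeDomain J)
    {ι : Type*} (Γ : QuantumPainleve.TwistedCycle J P m T ι) :
    -- the integral converges absolutely
    (∀ x : ℂ, ∀ t ∈ T,
      (∀ s, MeasureTheory.IntegrableOn
        (QuantumPainleve.pullbackIntegrand (Γ.cube s) x t) (QuantumPainleve.stdCube m)) ∧
      Summable fun s => ∫ p in QuantumPainleve.stdCube m,
        ‖QuantumPainleve.pullbackIntegrand (Γ.cube s) x t p‖) ∧
    -- it is a polynomial in `x` of degree at most `m` with holomorphic coefficients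
    (∃ φ : Fin (m + 1) → ℂ → ℂ, (∀ i, DifferentiableOn ℂ (φ i) T) ∧
      ∀ x : ℂ, ∀ t ∈ T,
        QuantumPainleve.hypergeometricIntegral Γ x t = ∑ i, φ i t * x ^ (i : ℕ)) ∧
    -- it solves the Schrödinger equation
    (∀ x : ℂ, ∀ t ∈ T,
      DifferentiableAt ℂ (fun t' => QuantumPainleve.hypergeometricIntegral Γ x t') t ∧
      P.hbar * deriv (fun t' => QuantumPainleve.hypergeometricIntegral Γ x t') t =
        QuantumPainleve.hamiltonian J P t
          (fun x' => QuantumPainleve.hypergeometricIntegral Γ x' t) x) := by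
  refine ⟨fun x t ht => ?_, ⟨fun i => QuantumPainleve.coeffIntegral Γ i, fun i t ht => ?_,
    fun x t ht => QuantumPainleve.hypergeometricIntegral_eq_sum Γ ht x⟩, fun x t ht => ⟨?_, ?_⟩⟩
  · have h := QuantumPainleve.moderateOn_polyPart_mul_eval (J := J) (P := P) (m := m)
      (K := {t}) Bornology.isBounded_singleton x
    simp only [QuantumPainleve.pullbackIntegrand_eq]
    exact ⟨fun s => QuantumPainleve.integrableOn_cubeIntegrand _ ht h,
      QuantumPainleve.summable_integral_norm Γ ht h⟩
  · exact (QuantumPainleve.hasDerivAt_coeffIntegral Γ hT ht i).differentiableAt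
      |>.differentiableWithinAt
  · exact (QuantumPainleve.hasDerivAt_hypergeometricIntegral Γ hT ht x).differentiableAt
  · exact QuantumPainleve.hypergeometricIntegral_schrodinger Γ hP hTJ hT ht x
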